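/- Let $\mathbb F_q$ be a finite field with $q$ elements, $n\ge 0$ an integer, $I$ an ideal of $\mathbb F_q[t]$, and $S=|I|\cup\{\infty\}$, where $|I|$ is the set of closed points of $\mathbb P^1\setminus\{\infty\}=\operatorname{Spec}\mathbb F_q[t]$ whose maximal ideal contains $I$. Let $\mathbb A^S$ be the ring of adeles of $\mathbb F_q(t)$ outside $S$ and $O^S\subset\mathbb A^S$ the subring of adeles without poles. The ring of Hecke correspondences is the ring $\mathcal H$ of $\mathbb Z$-valued continuous functions with compact support on $GL_n(\mathbb A^S)$ that are invariant on both sides under $K=GL_n(O^S)$, with convolution with respect to the Haar measure for which $K$ has measure $1$. For nonzero ideals $J_1\subseteq\dots\subseteq J_n$ of $\mathbb F_q[t]$ coprime to $I$, with $J_i=q_i\,\mathbb F_q[t]$, let $T(J_1,\dots,J_n)\in\mathcal H$ be the characteristic function of $K\,\mathrm{diag}(q_1,\dots,q_n)\,K$, and let $T(m)$ be the (finite) sum of all $T(J_1,\dots,J_n)$ with $\sum_i\dim_{\mathbb F_q}\mathbb F_q[t]/J_i=m$. For a closed point $x\in|\mathbb P^1|\setminus S$ let $\deg x$ be its degree over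 $\mathbb F_q$, let $q_x=q^{\deg x}$, let $t_x$ be a uniformizer of the completion of $\mathbb F_q(t)$ at $x$, and let $\mu_x$ be the idele outside $S$ with component $t_x$ at $x$ and $1$ at all other places. For $1\le j\le n$ let $\sigma^x_j\in\mathcal H$ be the characteristic function of $K\,\mathrm{diag}(\mu_x,\dots,\mu_x,1,\dots,1)\,K$, with $j$ entries $\mu_x$. Put $$L^x=\frac{1}{1-\sigma^x_1 z^{\deg x}+q_x\,\sigma^x_2 z^{2\deg x}-\cdots+(-1)^n q_x^{n(n-1)/2}\sigma^x_n z^{n\deg x}}\in\mathcal H[[z]].$$ Then $$\prod_{x\in|\mathbb P^1|\setminus S}L^x=\sum_{m\ge0}T(m)\,z^m\quad\text{in }\mathcal H[[z]],$$ that is: for every $m\ge 0$ there is a finite set $s\subset|\mathbb P^1|\setminus S$ such that, for every finite set of places of $|\mathbb P^1|\setminus S$ containing $s$ and every ordering of it, the product of the corresponding $L^x$ has $T(m)$ as coefficient of $z^m$. -/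

import Mathlib

open Polynomial IsDedekindDomain
open scoped RestrictedProduct MatrixGroups

/-- The Hecke ring of a topological group `G` with respect to a subgroup `U`: the continuous
functions `G → ℤ` with compact support that are invariant under `U` on the left and on the right.
It is a ring under convolution when `U` is open and compact. -/
@[ext]
structure HeckeAlgebra (G : Type*) [Group G] [TopologicalSpace G] (U : OpenSubgroup G) where
  toFun : G → ℤ
  continuous_toFun : Continuous toFun
  hasCompactSupport : HasCompactSupport toFun
  left_invariant : ∀ u ∈ U, ∀ g, toFun (u * g) = toFun g
  right_invariant : ∀ u ∈ U, ∀ g, toFun (g * u) = toFun g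

namespace HeckeAlgebra

section

set_option linter.unusedSectionVars false

variable {G : Type*} [Group G] [TopologicalSpace G] [IsTopologicalGroup G] {U : OpenSubgroup G}

theorem continuous_of_right_invariant (f : G → ℤ) (hf : ∀ u ∈ U, ∀ g, f (g * u) = f g) :
    Continuous f := by
  refine (IsLocallyConstant.iff_exists_open f).2 (fun x => ?_) |>.continuous
  refine ⟨(fun y => x⁻¹ * y) ⁻¹' (U : Set G), U.isOpen.preimage (by fun_prop), by simp, ?_⟩
  intro y hy
  have := hf (x⁻¹ * y) hy x
  simpa using this

theorem out_mem (y : G) : ∃ u ∈ U, (QuotientGroup.mk y : G ⧸ U.toSubgroup).out = y * u := by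
  obtain ⟨u, hu⟩ := QuotientGroup.mk_out_eq_mul U.toSubgroup y
  exact ⟨u, u.2, hu⟩

theorem apply_out (φ : G → ℤ) (hφ : ∀ u ∈ U, ∀ g, φ (g * u) = φ g) (y : G) :
    φ (QuotientGroup.mk y : G ⧸ U.toSubgroup).out = φ y := by
  obtain ⟨u, hu, h⟩ := out_mem (U := U) y
  rw [h, hφ u hu]

/-- Summation over `G ⧸ U` of a right `U`-invariant function is invariant under left translation. -/
theorem finsum_translate (φ : G → ℤ) (hφ : ∀ u ∈ U, ∀ g, φ (g * u) = φ g) (g : G) :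
    ∑ᶠ y : G ⧸ U.toSubgroup, φ (g * y.out) = ∑ᶠ y : G ⧸ U.toSubgroup, φ y.out := by
  rw [← finsum_comp_equiv (MulAction.toPerm g : Equiv.Perm (G ⧸ U.toSubgroup))
    (f := fun y => φ y.out)]
  refine finsum_congr fun y => ?_
  rw [← apply_out (U := U) φ hφ (g * y.out)]
  congr 2
  simp only [MulAction.toPerm_apply]
  conv_rhs => rw [← QuotientGroup.out_eq' y]
  rfl

theorem finite_support (f : HeckeAlgebra G U) :
    {y : G ⧸ U.toSubgroup | f.toFun y.out ≠ 0}.Finite := by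
  have h1 : IsCompact ((QuotientGroup.mk : G → G ⧸ U.toSubgroup) '' (tsupport f.toFun)) :=
    f.hasCompactSupport.isCompact.image continuous_quot_mk
  refine (isCompact_iff_finite.1 h1).subset fun y hy => ⟨y.out, subset_tsupport _ hy, ?_⟩
  exact QuotientGroup.out_eq' y

instance : Zero (HeckeAlgebra G U) :=
  ⟨⟨0, continuous_const, HasCompactSupport.zero, by simp, by simp⟩⟩

instance : Add (HeckeAlgebra G U) :=
  ⟨fun f g => ⟨f.toFun + g.toFun, f.continuous_toFun.add g.continuous_toFun,
    f.hasCompactSupport.add g.hasCompactSupport,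
    fun u hu x => by simp [f.left_invariant u hu, g.left_invariant u hu],
    fun u hu x => by simp [f.right_invariant u hu, g.right_invariant u hu]⟩⟩

instance : Neg (HeckeAlgebra G U) :=
  ⟨fun f => ⟨-f.toFun, f.continuous_toFun.neg, f.hasCompactSupport.neg,
    fun u hu x => by simp [f.left_invariant u hu],
    fun u hu x => by simp [f.right_invariant u hu]⟩⟩

theorem indicator_left_invariant (g : G) : ∀ u ∈ U, ∀ x,
    (DoubleCoset.doubleCoset g (U : Set G) U).indicator (1 : G → ℤ) (u * x) =
      (DoubleCoset.doubleCoset g (U : Set G) U).indicator 1 x := by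
  intro u hu x
  have : u * x ∈ DoubleCoset.doubleCoset g (U : Set G) U ↔
      x ∈ DoubleCoset.doubleCoset g (U : Set G) U := by
    simp only [DoubleCoset.mem_doubleCoset]
    constructor
    · rintro ⟨a, ha, b, hb, h⟩
      exact ⟨u⁻¹ * a, U.mul_mem (U.inv_mem hu) ha, b, hb, by
        rw [mul_assoc, mul_assoc, ← mul_assoc a, ← h, inv_mul_cancel_left]⟩
    · rintro ⟨a, ha, b, hb, h⟩
      exact ⟨u * a, U.mul_mem hu ha, b, hb, by rw [h]; simp [mul_assoc]⟩
  classical simp only [Set.indicator_apply, this]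
  simp

theorem indicator_right_invariant (g : G) : ∀ u ∈ U, ∀ x,
    (DoubleCoset.doubleCoset g (U : Set G) U).indicator (1 : G → ℤ) (x * u) =
      (DoubleCoset.doubleCoset g (U : Set G) U).indicator 1 x := by
  intro u hu x
  have : x * u ∈ DoubleCoset.doubleCoset g (U : Set G) U ↔
      x ∈ DoubleCoset.doubleCoset g (U : Set G) U := by
    simp only [DoubleCoset.mem_doubleCoset]
    constructor
    · rintro ⟨a, ha, b, hb, h⟩
      exact ⟨a, ha, b * u⁻¹, U.mul_mem hb (U.inv_mem hu), by
        rw [← mul_assoc, ← h, mul_inv_cancel_right]⟩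
    · rintro ⟨a, ha, b, hb, h⟩
      exact ⟨a, ha, b * u, U.mul_mem hb hu, by rw [h]; simp [mul_assoc]⟩
  classical simp only [Set.indicator_apply, this]
  simp

theorem isCompact_doubleCoset [CompactSpace U] (g : G) :
    IsCompact (DoubleCoset.doubleCoset g (U : Set G) U) := by
  have hU : IsCompact (U : Set G) := isCompact_iff_compactSpace.2 ‹_›
  have := (hU.mul (isCompact_singleton (x := g))).mul hU
  exact this

/-- The characteristic function of the double coset `U g U`. -/
noncomputable def charFn [CompactSpace U] (g : G) : HeckeAlgebra G U where
  toFun := (DoubleCoset.doubleCoset g (U : Set G) U).indicator 1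
  continuous_toFun := continuous_of_right_invariant (U := U) _ (indicator_right_invariant g)
  hasCompactSupport := HasCompactSupport.intro (isCompact_doubleCoset (U := U) g)
    fun _ hx => Set.indicator_of_notMem hx _
  left_invariant := indicator_left_invariant g
  right_invariant := indicator_right_invariant g

theorem charFn_apply [CompactSpace U] (g x : G) : (charFn g : HeckeAlgebra G U).toFun x =
    (DoubleCoset.doubleCoset g (U : Set G) U).indicator 1 x := rfl

/-- The unit of the Hecke ring is the characteristic function of `U`. -/
noncomputable instance [CompactSpace U] : One (HeckeAlgebra G U) := ⟨charFn 1⟩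

theorem one_apply [CompactSpace U] (x : G) :
    (1 : HeckeAlgebra G U).toFun x = (U : Set G).indicator 1 x := by
  change (DoubleCoset.doubleCoset 1 (U : Set G) U).indicator 1 x = _
  congr 1
  ext y
  rw [DoubleCoset.mem_doubleCoset]
  constructor
  · rintro ⟨a, ha, b, hb, rfl⟩
    simpa using U.mul_mem ha hb
  · exact fun h => ⟨y, h, 1, U.one_mem, by simp⟩

theorem conv_right_invariant (f g : HeckeAlgebra G U) (x : G) :
    ∀ u ∈ U, ∀ z, f.toFun (z * u) * g.toFun ((z * u)⁻¹ * x) = f.toFun z * g.toFun (z⁻¹ * x) := by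
  intro u hu z
  rw [f.right_invariant u hu, mul_inv_rev, mul_assoc, g.left_invariant _ (U.inv_mem hu)]

/-- Convolution with respect to the Haar measure of `G` that gives `U` the measure `1`:
`(f * g)(x) = ∑_{y ∈ G ⧸ U} f(y) g(y⁻¹ x)`. The summand depends only on the coset of `y`, and it
vanishes for all but finitely many cosets. -/
noncomputable instance : Mul (HeckeAlgebra G U) :=
  ⟨fun f g =>
    have hr : ∀ u ∈ U, ∀ x, (∑ᶠ y : G ⧸ U.toSubgroup, f.toFun y.out * g.toFun (y.out⁻¹ * (x * u))) =
        ∑ᶠ y : G ⧸ U.toSubgroup, f.toFun y.out * g.toFun (y.out⁻¹ * x) := by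
      intro u hu x
      refine finsum_congr fun y => ?_
      rw [← mul_assoc, g.right_invariant u hu]
    { toFun := fun x => ∑ᶠ y : G ⧸ U.toSubgroup, f.toFun y.out * g.toFun (y.out⁻¹ * x)
      continuous_toFun := continuous_of_right_invariant (U := U) _ hr
      hasCompactSupport := by
        refine HasCompactSupport.intro
          (f.hasCompactSupport.isCompact.mul g.hasCompactSupport.isCompact) fun x hx => ?_
        refine finsum_eq_zero_of_forall_eq_zero fun y => ?_
        by_contra h
        refine hx ⟨y.out, subset_tsupport _ (left_ne_zero_of_mul h), y.out⁻¹ * x,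
          subset_tsupport _ (right_ne_zero_of_mul h), by simp⟩
      left_invariant := fun u hu x => by
        rw [← finsum_translate (U := U) (fun y => f.toFun y * g.toFun (y⁻¹ * (u * x)))
          (conv_right_invariant f g (u * x)) u]
        refine finsum_congr fun y => ?_
        rw [f.left_invariant u hu]
        congr 2
        group
      right_invariant := hr }⟩

theorem mul_apply (f g : HeckeAlgebra G U) (x : G) :
    (f * g).toFun x = ∑ᶠ y : G ⧸ U.toSubgroup, f.toFun y.out * g.toFun (y.out⁻¹ * x) := rfl

theorem finite_support_mul (f : HeckeAlgebra G U) (φ : G ⧸ U.toSubgroup → ℤ) :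
    (Function.support fun y : G ⧸ U.toSubgroup => f.toFun y.out * φ y).Finite :=
  f.finite_support.subset fun _ h => left_ne_zero_of_mul h

theorem mul_assoc' (f g h : HeckeAlgebra G U) : f * g * h = f * (g * h) := by
  ext x
  simp only [mul_apply]
  have e1 : ∀ y : G ⧸ U.toSubgroup,
      (∑ᶠ z : G ⧸ U.toSubgroup, f.toFun z.out * g.toFun (z.out⁻¹ * y.out)) * h.toFun (y.out⁻¹ * x) =
      ∑ᶠ z : G ⧸ U.toSubgroup,
        f.toFun z.out * (g.toFun (z.out⁻¹ * y.out) * h.toFun (y.out⁻¹ * x)) := by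
    intro y
    rw [finsum_mul]
    exact finsum_congr fun z => mul_assoc _ _ _
  have e2 : ∀ z : G ⧸ U.toSubgroup,
      f.toFun z.out * (∑ᶠ w : G ⧸ U.toSubgroup, g.toFun w.out * h.toFun (w.out⁻¹ * (z.out⁻¹ * x))) =
      ∑ᶠ y : G ⧸ U.toSubgroup,
        f.toFun z.out * (g.toFun (z.out⁻¹ * y.out) * h.toFun (y.out⁻¹ * x)) := by
    intro z
    rw [← mul_finsum]
    congr 1
    rw [← finsum_translate (U := U) (fun w => g.toFun w * h.toFun (w⁻¹ * (z.out⁻¹ * x)))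
      (conv_right_invariant g h (z.out⁻¹ * x)) z.out⁻¹]
    refine finsum_congr fun y => ?_
    congr 2
    group
  rw [finsum_congr e1, finsum_congr e2]
  have hs : ∀ z : G ⧸ U.toSubgroup, (Function.support fun y : G ⧸ U.toSubgroup =>
      f.toFun z.out * (g.toFun (z.out⁻¹ * y.out) * h.toFun (y.out⁻¹ * x))).Finite := by
    intro z
    refine ((g.finite_support).image (fun w => z.out • w)).subset fun y hy => ?_
    have hg := left_ne_zero_of_mul (right_ne_zero_of_mul hy)
    refine ⟨QuotientGroup.mk (z.out⁻¹ * y.out), ?_, ?_⟩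
    · rw [Set.mem_ofPred_eq, apply_out (U := U) _ g.right_invariant]
      exact hg
    · change QuotientGroup.mk (z.out * (z.out⁻¹ * y.out)) = y
      rw [mul_inv_cancel_left]
      exact QuotientGroup.out_eq' y
  have hF := f.finite_support
  rw [finsum_eq_sum_of_support_subset (s := hF.toFinset)
    (fun z => ∑ᶠ y : G ⧸ U.toSubgroup,
        f.toFun z.out * (g.toFun (z.out⁻¹ * y.out) * h.toFun (y.out⁻¹ * x)))]
  · rw [← finsum_sum_comm _ _ fun z _ => hs z]
    refine finsum_congr fun y => finsum_eq_sum_of_support_subset _ fun z hz => ?_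
    simpa using left_ne_zero_of_mul hz
  · intro z hz
    simp only [Set.Finite.coe_toFinset, Set.mem_ofPred_eq]
    intro h0
    exact hz (by simp [h0])

theorem one_mul' [CompactSpace U] (f : HeckeAlgebra G U) : 1 * f = f := by
  ext x
  rw [mul_apply, finsum_eq_single _ (QuotientGroup.mk 1)]
  · obtain ⟨u, hu, h⟩ := out_mem (U := U) (1 : G)
    rw [h, one_mul, one_apply, Set.indicator_of_mem hu, f.left_invariant _ (U.inv_mem hu)]
    simp
  · intro y hy
    rw [one_apply, Set.indicator_of_notMem, zero_mul]
    intro h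
    apply hy
    rw [← QuotientGroup.out_eq' y]
    exact (QuotientGroup.eq.2 (by simpa using h)).symm

theorem mul_one' [CompactSpace U] (f : HeckeAlgebra G U) : f * 1 = f := by
  ext x
  rw [mul_apply, finsum_eq_single _ (QuotientGroup.mk x)]
  · rw [apply_out (U := U) _ f.right_invariant]
    obtain ⟨u, hu, h⟩ := out_mem (U := U) x
    rw [h, one_apply, Set.indicator_of_mem]
    · simp
    · simpa using U.inv_mem hu
  · intro y hy
    rw [one_apply, Set.indicator_of_notMem, mul_zero]
    intro h
    apply hy
    rw [← QuotientGroup.out_eq' y]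
    exact QuotientGroup.eq.2 h

noncomputable instance [CompactSpace U] : Ring (HeckeAlgebra G U) where
  add_assoc f g h := by ext x; exact add_assoc _ _ _
  zero_add f := by ext x; exact zero_add _
  add_zero f := by ext x; exact add_zero _
  add_comm f g := by ext x; exact add_comm _ _
  neg_add_cancel f := by ext x; exact neg_add_cancel (f.toFun x)
  nsmul := nsmulRec
  zsmul := zsmulRec
  mul_assoc := mul_assoc'
  one_mul := one_mul'
  mul_one := mul_one'
  zero_mul f := by
    ext x
    exact finsum_eq_zero_of_forall_eq_zero fun y => zero_mul _
  mul_zero f := by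
    ext x
    exact finsum_eq_zero_of_forall_eq_zero fun y => mul_zero _
  left_distrib f g h := by
    ext x
    change _ = (f * g).toFun x + (f * h).toFun x
    simp only [mul_apply]
    rw [← finsum_add_distrib (finite_support_mul f _) (finite_support_mul f _)]
    exact finsum_congr fun y => mul_add _ _ _
  right_distrib f g h := by
    ext x
    change _ = (f * h).toFun x + (g * h).toFun x
    simp only [mul_apply]
    rw [← finsum_add_distrib (finite_support_mul f _) (finite_support_mul g _)]
    exact finsum_congr fun y => add_mul _ _ _

end

end HeckeAlgebra

section Adeles

variable (F : Type*) [Field F]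

/-- The closed points of the projective line over `F` outside `S = |I| ∪ {∞}`, where `I` is an ideal
of `F[t]`: the maximal ideals of `F[t]` that do not contain `I`. -/
abbrev Place (I : Ideal F[X]) : Type _ :=
  {x : HeightOneSpectrum F[X] // ¬ I ≤ x.asIdeal}

namespace Place

variable {F} {I : Ideal F[X]}

/-- The completion of `F(t)` at `x`. -/
abbrev Completion (x : Place F I) : Type _ := x.1.adicCompletion (RatFunc F)

/-- The valuation ring of the completion of `F(t)` at `x`. -/
noncomputable abbrev Integers (x : Place F I) : ValuationSubring x.Completion :=
  x.1.adicCompletionIntegers (RatFunc F)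

/-- The degree of the closed point `x` over `F`. -/
noncomputable def degree (x : Place F I) : ℕ := Module.finrank F (F[X] ⧸ x.1.asIdeal)

/-- The cardinality `q ^ deg x` of the residue field at `x`. -/
noncomputable def residueCard (x : Place F I) : ℕ := Nat.card (F[X] ⧸ x.1.asIdeal)

/-- The element `t` of the completion at `x` is a local uniformizer. -/
def IsUniformizer (x : Place F I) (t : x.Completionˣ) : Prop :=
  Valued.v (t : x.Completion) = WithZero.exp (-1 : ℤ)

end Place

/-- The ring of adeles of `F(t)` outside `S = |I| ∪ {∞}`, with the restricted product topology. -/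
noncomputable abbrev AdeleOutside (I : Ideal F[X]) : Type _ :=
  Πʳ x : Place F I, [x.Completion, x.Integers]

variable (I : Ideal F[X])

/-- The subring `O^S` of adeles without poles. -/
noncomputable def integralAdeles : Subring (AdeleOutside F I) where
  carrier := {a | ∀ x, a x ∈ x.Integers}
  mul_mem' ha hb x := mul_mem (ha x) (hb x)
  one_mem' x := one_mem x.Integers
  add_mem' ha hb x := add_mem (ha x) (hb x)
  zero_mem' x := zero_mem x.Integers
  neg_mem' ha x := neg_mem (ha x)

instance : Fact (∀ x : Place F I, IsOpen (x.Integers : Set x.Completion)) :=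
  ⟨fun _ => Valued.isOpen_valuationSubring _⟩

theorem finite_quotient [Finite F] (x : HeightOneSpectrum F[X]) : Finite (F[X] ⧸ x.asIdeal) := by
  obtain ⟨p, hp⟩ := (inferInstance : x.asIdeal.IsPrincipal)
  have hp0 : p ≠ 0 := by
    rintro rfl
    exact x.ne_bot (by simp [hp])
  have : Module.Finite F (F[X] ⧸ x.asIdeal) := by
    rw [hp]
    have : Module.Finite F (AdjoinRoot p) := (AdjoinRoot.powerBasis hp0).finite
    exact this
  exact Module.finite_of_finite F

theorem finite_residueField {R : Type*} [CommRing R] [IsDedekindDomain R] (K : Type*) [Field K]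
    [Algebra R K] [IsFractionRing R K] (v : HeightOneSpectrum R) [Finite (R ⧸ v.asIdeal)] :
    Finite (IsLocalRing.ResidueField (v.adicCompletionIntegers K)) := by
  let f : R →+* IsLocalRing.ResidueField (v.adicCompletionIntegers K) :=
    (IsLocalRing.residue _).comp (algebraMap R (v.adicCompletionIntegers K))
  have hf : ∀ a ∈ v.asIdeal, f a = 0 := by
    intro a ha
    change IsLocalRing.residue _ _ = 0
    rw [IsLocalRing.residue_eq_zero_iff]
    refine (Valuation.mem_maximalIdeal_iff _ _).2 ?_
    change Valued.v (algebraMap R (v.adicCompletion K) a) < 1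
    exact (v.valuedAdicCompletion_eq_valuation a).trans_lt ((v.valuation_lt_one_iff_mem a).2 ha)
  have hs : Function.Surjective (Ideal.Quotient.lift v.asIdeal f hf) := by
    apply Ideal.Quotient.lift_surjective_of_surjective
    intro y
    obtain ⟨z, rfl⟩ := IsLocalRing.residue_surjective y
    obtain ⟨k, hk⟩ : ∃ k : K, Valued.v ((k : v.adicCompletion K) - z) < 1 := by
      have hn : {w : v.adicCompletion K | Valued.v (w - z) < 1} ∈ nhds (z : v.adicCompletion K) :=
        (Valued.mem_nhds (R := v.adicCompletion K)).2 ⟨1, by simp⟩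
      obtain ⟨_, hk, k, rfl⟩ := mem_closure_iff_nhds.1
        (HeightOneSpectrum.denseRange_algebraMap K v (z : v.adicCompletion K)) _ hn
      exact ⟨k, hk⟩
    have hk1 : v.valuation K k ≤ 1 := by
      rw [← HeightOneSpectrum.valuedAdicCompletion_eq_valuation']
      have := Valued.v.map_add ((k : v.adicCompletion K) - z) z
      rw [sub_add_cancel] at this
      exact this.trans (max_le hk.le z.2)
    obtain ⟨a, ha⟩ := v.exists_valuation_sub_lt_of_integer hk1 1
    refine ⟨a, ?_⟩
    rw [← sub_eq_zero]
    change IsLocalRing.residue _ (algebraMap R (v.adicCompletionIntegers K) a) - _ = 0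
    rw [← map_sub, IsLocalRing.residue_eq_zero_iff]
    refine (Valuation.mem_maximalIdeal_iff _ _).2 ?_
    change Valued.v (((algebraMap R K a : K) : v.adicCompletion K) - z) < 1
    have ha' : Valued.v (((algebraMap R K a : K) : v.adicCompletion K) - k) < 1 := by
      rw [Units.val_one, ← HeightOneSpectrum.valuedAdicCompletion_eq_valuation'] at ha
      have h1 : ((algebraMap R K a - k : K) : v.adicCompletion K) =
          ((algebraMap R K a : K) : v.adicCompletion K) - k :=
        map_sub (algebraMap K (v.adicCompletion K)) _ _
      rwa [h1] at ha
    have := Valued.v.map_add (((algebraMap R K a : K) : v.adicCompletion K) - k) (k - z)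
    rw [sub_add_sub_cancel] at this
    exact this.trans_lt (max_lt ha' hk)
  exact Finite.of_surjective _ hs

theorem compactSpace_integers {R : Type*} [CommRing R] [IsDedekindDomain R] (K : Type*) [Field K]
    [Algebra R K] [IsFractionRing R K] (v : HeightOneSpectrum R) [Finite (R ⧸ v.asIdeal)] :
    CompactSpace (v.adicCompletionIntegers K) := by
  let _ : (Valued.v : Valuation (v.adicCompletion K) (WithZero (Multiplicative ℤ))).RankOne :=
    Valuation.IsRankOneDiscrete.rankOne _ (e := 2) (by norm_num)
  have hf := finite_residueField K v
  have hc : IsComplete ((v.adicCompletionIntegers K : Set (v.adicCompletion K))) :=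
    (Valued.isClosed_valuationSubring _).isComplete
  have := (Valued.integer.compactSpace_iff_completeSpace_and_isDiscreteValuationRing_and_finite_residueField
    (K := v.adicCompletion K)).2
    ⟨completeSpace_coe_iff_isComplete.2 hc,
      (inferInstance : IsDiscreteValuationRing (v.adicCompletionIntegers K)), hf⟩
  exact this

instance [Finite F] : CompactSpace (integralAdeles F I) := by
  have : ∀ x : Place F I, CompactSpace x.Integers := fun x =>
    have := finite_quotient F x.1
    compactSpace_integers (RatFunc F) x.1
  suffices h : IsCompact (integralAdeles F I : Set (AdeleOutside F I)) from
    isCompact_iff_compactSpace.1 h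
  have h : (integralAdeles F I : Set (AdeleOutside F I)) =
      Set.range (RestrictedProduct.structureMap (fun x : Place F I => x.Completion)
        (fun x => (x.Integers : Set x.Completion)) Filter.cofinite) := by
    rw [RestrictedProduct.range_structureMap]
    rfl
  rw [h]
  exact isCompact_range RestrictedProduct.isEmbedding_structureMap.continuous

theorem isOpen_integralAdeles : IsOpen (integralAdeles F I : Set (AdeleOutside F I)) :=
  RestrictedProduct.isOpen_forall_mem fun _ => Valued.isOpen_valuationSubring _

variable (n : ℕ)

/-- The inclusion `GL_n(O^S) → GL_n(A^S)`. -/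
noncomputable def integralGLHom : GL (Fin n) (integralAdeles F I) →* GL (Fin n) (AdeleOutside F I) :=
  Matrix.GeneralLinearGroup.map (integralAdeles F I).subtype

theorem continuous_integralGLHom : Continuous (integralGLHom F I n) :=
  Continuous.units_map _ (by
    change Continuous fun M : Matrix (Fin n) (Fin n) (integralAdeles F I) => M.map Subtype.val
    fun_prop)

theorem mem_range_integralGLHom (g : GL (Fin n) (AdeleOutside F I)) :
    g ∈ (integralGLHom F I n).range ↔
      (∀ i j, g.val i j ∈ integralAdeles F I) ∧ ∀ i j, g⁻¹.val i j ∈ integralAdeles F I := by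
  constructor
  · rintro ⟨h, rfl⟩
    refine ⟨fun i j => (h.val i j).2, fun i j => ?_⟩
    rw [← map_inv]
    exact (h⁻¹.val i j).2
  · rintro ⟨h1, h2⟩
    have key : ∀ A B : Matrix (Fin n) (Fin n) (integralAdeles F I),
        A.map (integralAdeles F I).subtype * B.map (integralAdeles F I).subtype = 1 → A * B = 1 := by
      intro A B h
      apply Matrix.map_injective (f := (integralAdeles F I).subtype) Subtype.val_injective
      change (A * B).map (integralAdeles F I).subtype = (1 : Matrix _ _ _).map (integralAdeles F I).subtype
      rw [Matrix.map_mul, h]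
      simp
    refine ⟨⟨Matrix.of fun i j => ⟨_, h1 i j⟩, Matrix.of fun i j => ⟨_, h2 i j⟩,
      key _ _ g.mul_inv, key _ _ g.inv_mul⟩, ?_⟩
    ext i j : 2
    rfl

/-- The open subgroup `GL_n(O^S)` of `GL_n(A^S)`. -/
noncomputable def integralGL : OpenSubgroup (GL (Fin n) (AdeleOutside F I)) where
  toSubgroup := (integralGLHom F I n).range
  isOpen' := by
    have h : ((integralGLHom F I n).range : Set (GL (Fin n) (AdeleOutside F I))) =
        (⋂ i, ⋂ j, (fun g => g.val i j) ⁻¹' (integralAdeles F I : Set (AdeleOutside F I))) ∩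
        (⋂ i, ⋂ j, (fun g => g⁻¹.val i j) ⁻¹' (integralAdeles F I : Set (AdeleOutside F I))) := by
      ext g
      simpa using mem_range_integralGLHom F I n g
    change IsOpen ((integralGLHom F I n).range : Set (GL (Fin n) (AdeleOutside F I)))
    rw [h]
    refine IsOpen.inter ?_ ?_ <;>
    refine isOpen_iInter_of_finite fun i => isOpen_iInter_of_finite fun j =>
      (isOpen_integralAdeles F I).preimage ?_
    · exact Units.continuous_val.matrix_elem i j
    · exact (Units.continuous_val.comp continuous_inv).matrix_elem i j

instance [Finite F] : CompactSpace (integralGL F I n) := by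
  have : CompactSpace (Matrix (Fin n) (Fin n) (integralAdeles F I)) :=
    inferInstanceAs (CompactSpace (Fin n → Fin n → integralAdeles F I))
  have : T1Space (Matrix (Fin n) (Fin n) (integralAdeles F I)) :=
    inferInstanceAs (T1Space (Fin n → Fin n → integralAdeles F I))
  refine isCompact_iff_compactSpace.1 ?_
  exact isCompact_range (continuous_integralGLHom F I n)

/-- The ring of Hecke correspondences: the `ℤ`-valued continuous functions with compact support on
`GL_n(A^S)` that are invariant under `GL_n(O^S)` on both sides, under convolution. -/
def HeckeCorrespondences : Type _ :=
  HeckeAlgebra (GL (Fin n) (AdeleOutside F I)) (integralGL F I n)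

noncomputable instance [Finite F] : Ring (HeckeCorrespondences F I n) :=
  inferInstanceAs (Ring (HeckeAlgebra (GL (Fin n) (AdeleOutside F I)) (integralGL F I n)))

variable {F I n}

/-- The diagonal matrix with given invertible diagonal entries. -/
def diagonalGL {R : Type*} [CommRing R] {n : ℕ} (d : Fin n → Rˣ) : GL (Fin n) R :=
  Units.map (Matrix.diagonalRingHom (Fin n) R).toMonoidHom (MulEquiv.piUnits.symm d)

open Classical in
/-- The idele outside `S` with component `t` at `x` and `1` at all other places. -/
noncomputable def localIdele (x : Place F I) (t : x.Completionˣ) : (AdeleOutside F I)ˣ where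
  val := RestrictedProduct.mulSingle (fun x : Place F I => x.Integers) x (t : x.Completion)
  inv := RestrictedProduct.mulSingle (fun x : Place F I => x.Integers) x ((t⁻¹ : x.Completionˣ) : x.Completion)
  val_inv := by rw [← RestrictedProduct.mulSingle_mul, t.mul_inv, RestrictedProduct.mulSingle_one]
  inv_val := by rw [← RestrictedProduct.mulSingle_mul, t.inv_mul, RestrictedProduct.mulSingle_one]

/-- The diagonal embedding of `F(t)` into the adeles outside `S`. -/
noncomputable def principalAdele : RatFunc F →+* AdeleOutside F I where
  toFun k := ⟨fun x => (k : x.Completion), by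
    have h := (HeightOneSpectrum.Support.finite F[X] k).preimage
      (Subtype.val_injective (p := fun x : HeightOneSpectrum F[X] => ¬ I ≤ x.asIdeal)).injOn
    refine h.subset fun x hx => ?_
    simpa [HeightOneSpectrum.Support, HeightOneSpectrum.mem_adicCompletionIntegers] using hx⟩
  map_one' := RestrictedProduct.ext _ _ fun _ => HeightOneSpectrum.adicCompletion.coe_one ..
  map_mul' _ _ := RestrictedProduct.ext _ _ fun _ => HeightOneSpectrum.adicCompletion.coe_mul ..
  map_zero' := RestrictedProduct.ext _ _ fun _ => HeightOneSpectrum.adicCompletion.coe_zero ..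
  map_add' _ _ := RestrictedProduct.ext _ _ fun _ => HeightOneSpectrum.adicCompletion.coe_add ..

/-- The idele `μ_J` outside `S` of a nonzero ideal `J` of `F[t]`: the image in each completion of
a generator of `J`. -/
noncomputable def idealIdele (J : Ideal F[X]) (hJ : J ≠ ⊥) : (AdeleOutside F I)ˣ :=
  Units.map (principalAdele (F := F) (I := I)).toMonoidHom
    (Units.mk0 (algebraMap F[X] (RatFunc F) (Submodule.IsPrincipal.generator J)) (by
      rw [Ne, FaithfulSMul.algebraMap_eq_zero_iff,
        ← Submodule.IsPrincipal.eq_bot_iff_generator_eq_zero]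
      exact hJ))

variable (F I n) in
/-- The chains `J_1 ⊆ ⋯ ⊆ J_n` of nonzero ideals of `F[t]` coprime to `I`. -/
@[ext]
structure IdealChain where
  ideal : Fin n → Ideal F[X]
  monotone : Monotone ideal
  ne_bot : ∀ i, ideal i ≠ ⊥
  coprime : ∀ i, IsCoprime (ideal i) I

/-- The total degree `∑ dim_F F[t] / J_i` of a chain. -/
noncomputable def IdealChain.degree (J : IdealChain F I n) : ℕ :=
  ∑ i, Module.finrank F (F[X] ⧸ J.ideal i)

theorem finite_ideal_finrank_le [Finite F] (m : ℕ) :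
    {J : Ideal F[X] | J ≠ ⊥ ∧ Module.finrank F (F[X] ⧸ J) ≤ m}.Finite := by
  have : Finite (Polynomial.degreeLT F (m + 1)) := Module.finite_of_finite F
  have h := (Set.toFinite ((Polynomial.degreeLT F (m + 1) : Set F[X]))).image
    (fun p => Ideal.span {p})
  refine h.subset ?_
  rintro J ⟨hJ, hm⟩
  obtain ⟨p, rfl⟩ := (inferInstance : J.IsPrincipal)
  refine ⟨p, ?_, rfl⟩
  have hp : p ≠ 0 := by
    rintro rfl
    exact hJ (by simp)
  have h2 : Module.finrank F (F[X] ⧸ Ideal.span {p}) ≤ m := hm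
  rw [finrank_quotient_span_eq_natDegree] at h2
  rw [SetLike.mem_coe, Polynomial.mem_degreeLT]
  exact (Polynomial.natDegree_lt_iff_degree_lt hp).1 (by omega)

theorem IdealChain.finite_degree_eq [Finite F] (m : ℕ) :
    {J : IdealChain F I n | J.degree = m}.Finite := by
  have h := (Set.Finite.pi (fun _ : Fin n => finite_ideal_finrank_le (F := F) m)).preimage
    (f := IdealChain.ideal (I := I))
    (Function.Injective.injOn fun _ _ h => IdealChain.ext h)
  refine h.subset fun J hJ => ?_
  simp only [Set.mem_preimage, Set.mem_pi, Set.mem_univ, forall_const]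
  intro i
  refine ⟨J.ne_bot i, ?_⟩
  rw [← (hJ : J.degree = m)]
  exact Finset.single_le_sum (f := fun i => Module.finrank F (F[X] ⧸ J.ideal i))
    (fun _ _ => Nat.zero_le _) (Finset.mem_univ i)

section Hecke

variable [Finite F]

/-- The Hecke correspondence `T(J_1, …, J_n)`. -/
noncomputable def heckeChain (J : IdealChain F I n) : HeckeCorrespondences F I n :=
  HeckeAlgebra.charFn (diagonalGL fun i => idealIdele (J.ideal i) (J.ne_bot i))

/-- The Hecke correspondence `T(m)`: the sum of the finitely many `T(J_1, …, J_n)` with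
`∑ dim_F F[t] / J_i = m`. -/
noncomputable def heckeT (F : Type*) [Field F] [Finite F] (I : Ideal F[X]) (n m : ℕ) :
    HeckeCorrespondences F I n :=
  ∑ J ∈ (IdealChain.finite_degree_eq (F := F) (I := I) (n := n) m).toFinset, heckeChain J

/-- The Hecke correspondence `σ^x_j`: the characteristic function of the double coset of
`diag(μ_x, …, μ_x, 1, …, 1)`, with `j` entries `μ_x`, where `μ_x` is the idele with component `t`
at `x` and `1` elsewhere. -/
noncomputable def heckeSigma (n : ℕ) (x : Place F I) (t : x.Completionˣ) (j : ℕ) :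
    HeckeCorrespondences F I n :=
  HeckeAlgebra.charFn (diagonalGL fun i : Fin n => if (i : ℕ) < j then localIdele x t else 1)

/-- The polynomial `1 + ∑_{1 ≤ j ≤ n} (-1)^j q_x^{j(j-1)/2} σ^x_j z^{j deg x}`, where
`q_x = q ^ deg x` is the cardinality of the residue field at `x`. -/
noncomputable def eulerPolynomial (n : ℕ) (x : Place F I) (t : x.Completionˣ) :
    PowerSeries (HeckeCorrespondences F I n) :=
  1 + ∑ j ∈ Finset.Icc 1 n, PowerSeries.monomial (j * x.degree)
    (((-1) ^ j * (x.residueCard : ℤ) ^ (j * (j - 1) / 2)) • heckeSigma n x t j)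

theorem Place.degree_pos (x : Place F I) : 0 < x.degree := by
  have := finite_quotient F x.1
  have := Module.Finite.of_finite (R := F) (M := F[X] ⧸ x.1.asIdeal)
  have : Nontrivial (F[X] ⧸ x.1.asIdeal) :=
    Ideal.Quotient.nontrivial_iff.2 x.1.isPrime.ne_top
  exact Module.finrank_pos

theorem constantCoeff_eulerPolynomial (n : ℕ) (x : Place F I) (t : x.Completionˣ) :
    PowerSeries.constantCoeff (eulerPolynomial n x t) = 1 := by
  rw [eulerPolynomial, map_add, map_one, map_sum, Finset.sum_eq_zero, add_zero]
  intro j hj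
  have h : 0 ≠ j * x.degree :=
    (Nat.mul_pos (by simp at hj; omega) (Place.degree_pos x)).ne
  rw [← PowerSeries.coeff_zero_eq_constantCoeff_apply, PowerSeries.coeff_monomial, if_neg h]

/-- The Euler factor `L^x`, the inverse of `eulerPolynomial` in the ring of formal power series. The
constant coefficient of `eulerPolynomial` is `1`, because `deg x ≥ 1`. -/
noncomputable def eulerFactor (n : ℕ) (x : Place F I) (t : x.Completionˣ) :
    PowerSeries (HeckeCorrespondences F I n) :=
  PowerSeries.invOfUnit (eulerPolynomial n x t) 1

theorem eulerPolynomial_mul_eulerFactor (n : ℕ) (x : Place F I) (t : x.Completionˣ) :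
    eulerPolynomial n x t * eulerFactor n x t = 1 :=
  PowerSeries.mul_invOfUnit _ _ (constantCoeff_eulerPolynomial n x t)

end Hecke

end Adeles

/-!
The Hecke correspondence `T(m)` is the characteristic function of the matrices in `GL_n(A^S)` that
have entries in `O^S` and determinant of degree `m`: by elementary divisors at each place, such a
matrix lies in the double coset of exactly one chain of ideals (`exists_mem_doubleCoset_diagonal`,
`idealChain_eq_of_mem_doubleCoset`, `heckeEval_heckeT`). For a set `s` of places let `T_s(m)`
(`heckeTOn`) be the characteristic function of those among these matrices that are invertible over
the local rings outside `s`, and let `Z_s` be the power series with coefficients `T_s(m)`.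

The heart of the proof is the identity `P_x * Z_s = Z_{s \ {x}}` for `x ∈ s`, where `P_x` is the
Euler polynomial (`eulerPolynomial_mul_heckeSeries`). The value at `g` of the convolution of
`σ^x_j` with `T_s(m - j deg x)` counts the cosets `y GL_n(O^S)` in the double coset of
`diag(μ_x, …, μ_x, 1, …, 1)` for which `y⁻¹ g` is again integral. Such cosets correspond to the
subspaces of codimension `j` of `k_x ^ n` that contain the column space of `g` modulo `x`
(`natCard_cosets_eq_natCard_subspaces`, `heckeEval_heckeSigma_mul`). The coefficient
`(-1)^j q_x^{j(j-1)/2}` is the Möbius function of the lattice of subspaces, so the alternating sum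
of these numbers is `1` if the column space is all of `k_x ^ n`, that is, if `g` is invertible at
`x`, and `0` otherwise (`sum_subspaceMoebius_mul_natCard`).

Since `P_x` has the inverse `L^x`, it follows that `Z_{s ∪ {x}} = L^x * Z_s` for `x ∉ s`, and by
induction, starting from `Z_∅ = 1`, the product of the `L^x` over a list of distinct places is the
series of its set of places. If this set contains all places of degree at most `m`, then
`T_s(m) = T(m)`.
-/

/-! ### The Möbius function of the lattice of subspaces -/

section SubspaceSum

variable {K V : Type*} [Field K] [AddCommGroup V] [Module K V]

/-- The linear forms with value `1` at `v` form a coset of the hyperplane of forms that vanish at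
`v`. -/
theorem natCard_dual_apply_eq_one [Module.Finite K V] {v : V} (hv : v ≠ 0) :
    Nat.card {φ : Module.Dual K V // φ v = 1} = Nat.card K ^ (Module.finrank K V - 1) := by
  obtain ⟨φ₁, h₁⟩ : ∃ φ : Module.Dual K V, φ v ≠ 0 := by
    by_contra! h
    exact hv ((Module.forall_dual_apply_eq_zero_iff K v).1 h)
  obtain ⟨φ₀, h₀⟩ : ∃ φ : Module.Dual K V, φ v = 1 := ⟨(φ₁ v)⁻¹ • φ₁, by simp [h₁]⟩
  let ev : Module.Dual K V →ₗ[K] K := Module.Dual.eval K V v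
  have hsurj : LinearMap.range ev = ⊤ :=
    LinearMap.range_eq_top.2 fun c => ⟨c • φ₀, by simp [ev, h₀]⟩
  have hrank := ev.finrank_range_add_finrank_ker
  rw [hsurj, finrank_top, Module.finrank_self, Subspace.dual_finrank_eq] at hrank
  have hker : Nat.card (LinearMap.ker ev) = Nat.card K ^ (Module.finrank K V - 1) := by
    rw [Module.natCard_eq_pow_finrank (K := K)]
    congr 1
    omega
  rw [← hker]
  refine Nat.card_congr ⟨fun φ => ⟨φ.1 - φ₀, by simp [ev, φ.2, h₀]⟩,
    fun ψ => ⟨ψ.1 + φ₀, ?_⟩, fun φ => by simp, fun ψ => by simp⟩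
  have : ψ.1 v = 0 := ψ.2
  simp [this, h₀]

/-- A complement of the line spanned by `v` in `W` is the kernel of a unique linear form on `W`
with value `1` at `v`. -/
theorem natCard_complement_line [Module.Finite K V] {W : Submodule K V} {v : W} (hv : v ≠ 0) :
    Nat.card {H : Submodule K V // H ⊔ Submodule.span K {(v : V)} = W ∧ (v : V) ∉ H} =
      Nat.card K ^ (Module.finrank K W - 1) := by
  rw [← natCard_dual_apply_eq_one hv]
  symm
  have key : ∀ φ : Module.Dual K W, φ v = 1 →
      ((LinearMap.ker φ).map W.subtype) ⊔ Submodule.span K {(v : V)} = W ∧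
        (v : V) ∉ (LinearMap.ker φ).map W.subtype := by
    intro φ hφ
    refine ⟨le_antisymm (sup_le (Submodule.map_subtype_le _ _) (by simp)) fun w hw => ?_, ?_⟩
    · rw [Submodule.mem_sup]
      refine ⟨w - φ ⟨w, hw⟩ • v, ⟨⟨w, hw⟩ - φ ⟨w, hw⟩ • v, ?_, rfl⟩, φ ⟨w, hw⟩ • v,
        Submodule.smul_mem _ _ (Submodule.mem_span_singleton_self _), by simp⟩
      simp [hφ]
    · rintro ⟨w, hw, h⟩
      have : w = v := Subtype.ext h
      subst this
      have hw' : φ w = 0 := hw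
      exact one_ne_zero (hφ.symm.trans hw')
  refine Nat.card_eq_of_bijective (fun φ => ⟨_, key φ.1 φ.2⟩) ⟨?_, ?_⟩
  · rintro ⟨φ, hφ⟩ ⟨ψ, hψ⟩ h
    have h1 : LinearMap.ker φ = LinearMap.ker ψ :=
      Submodule.map_injective_of_injective W.subtype_injective (Subtype.ext_iff.1 h)
    refine Subtype.ext (LinearMap.ext fun w => ?_)
    have h2 : w - φ w • v ∈ LinearMap.ker φ := by simp [hφ]
    rw [h1] at h2
    have h3 : ψ (w - φ w • v) = 0 := h2
    rw [map_sub, map_smul, hψ, smul_eq_mul, mul_one, sub_eq_zero] at h3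
    exact h3.symm
  · rintro ⟨H, h1, h2⟩
    have h3 : v ∉ H.comap W.subtype := h2
    obtain ⟨f, hf, hf'⟩ := Submodule.exists_le_ker_of_notMem h3
    have hs : ((f v)⁻¹ • f) v = 1 := by simp [hf]
    refine ⟨⟨(f v)⁻¹ • f, hs⟩, Subtype.ext ?_⟩
    have hle : H ≤ W := h1 ▸ le_sup_left
    refine le_antisymm ?_ fun w hw => ⟨⟨w, hle hw⟩, ?_, rfl⟩
    · rintro _ ⟨w, hw, rfl⟩
      have hw' := h1.ge w.2
      rw [Submodule.mem_sup] at hw'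
      obtain ⟨a, ha, b, hb, hab⟩ := hw'
      obtain ⟨c, rfl⟩ := Submodule.mem_span_singleton.1 hb
      have hw2 : w = ⟨a, hle ha⟩ + c • v := Subtype.ext hab.symm
      have hfa : f ⟨a, hle ha⟩ = 0 := hf' (show (⟨a, hle ha⟩ : W) ∈ H.comap W.subtype from ha)
      have hw3 : ((f v)⁻¹ • f) w = 0 := hw
      rw [hw2, map_add, map_smul, hs] at hw3
      simp only [LinearMap.smul_apply, hfa, smul_eq_mul, mul_zero, zero_add, mul_one] at hw3
      subst hw3
      simpa [← hab] using ha
    · have : f ⟨w, hle hw⟩ = 0 := hf' (show (⟨w, hle hw⟩ : W) ∈ H.comap W.subtype from hw)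
      simp [this]

/-- The coefficient `(-1)^c q^{c(c-1)/2}`: the Möbius function between a subspace of codimension `c`
and the whole space in the lattice of subspaces over a field with `q` elements. -/
def subspaceMoebius (q c : ℕ) : ℤ := (-1) ^ c * (q : ℤ) ^ (c * (c - 1) / 2)

theorem subspaceMoebius_succ (q c : ℕ) : subspaceMoebius q (c + 1) = -(subspaceMoebius q c * (q : ℤ) ^ c) := by
  have h : (c + 1) * (c + 1 - 1) / 2 = c * (c - 1) / 2 + c := by
    rw [← Finset.sum_range_id_mul_two] at *
    simp [← Finset.sum_range_id, Finset.sum_range_succ]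
  rw [subspaceMoebius, subspaceMoebius, h]
  ring

theorem finrank_quotient_comap_mkQ [Module.Finite K V] (U : Submodule K V)
    (W : Submodule K (V ⧸ U)) :
    Module.finrank K (V ⧸ W.comap U.mkQ) = Module.finrank K ((V ⧸ U) ⧸ W) := by
  have e := (Submodule.quotientQuotientEquivQuotient U (W.comap U.mkQ)
    (Submodule.le_comap_mkQ U W)).finrank_eq
  rw [← e, Submodule.map_comap_eq_of_surjective U.mkQ_surjective]

/-- Subspaces that contain `U` correspond to subspaces of the quotient by `U`, with the same
codimension. -/
theorem finsum_subspaces_ge [Module.Finite K V] (U : Submodule K V) (f : ℕ → ℤ) :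
    ∑ᶠ W : {W : Submodule K V // U ≤ W}, f (Module.finrank K (V ⧸ W.1)) =
      ∑ᶠ W : Submodule K (V ⧸ U), f (Module.finrank K ((V ⧸ U) ⧸ W)) := by
  refine (finsum_comp_equiv (Submodule.comapMkQRelIso U).toEquiv
    (f := fun W : {W : Submodule K V // U ≤ W} => f (Module.finrank K (V ⧸ W.1)))).symm.trans ?_
  exact finsum_congr fun W => congrArg f (finrank_quotient_comap_mkQ U W)

/-- The Möbius function of the lattice of subspaces sums to zero over the subspaces of a nonzero
space. The subspaces are grouped by their span with a fixed line. -/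
theorem finsum_subspaceMoebius [Finite K] [Module.Finite K V] :
    ∑ᶠ W : Submodule K V, subspaceMoebius (Nat.card K) (Module.finrank K (V ⧸ W)) =
      if Module.finrank K V = 0 then 1 else 0 := by
  classical
  induction hd : Module.finrank K V using Nat.strong_induction_on generalizing V with
  | _ d ih =>
  have : Finite V := Module.finite_of_finite K
  let _ := Fintype.ofFinite (Submodule K V)
  split_ifs with h0
  · have : Subsingleton V := Module.finrank_zero_iff.1 (hd.trans h0)
    have e : ∀ W : Submodule K V, W = ⊥ := fun W => Subsingleton.elim _ _
    rw [finsum_eq_single _ ⊥ fun W hW => absurd (e W) hW]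
    have : Module.finrank K (V ⧸ (⊥ : Submodule K V)) = 0 := Module.finrank_zero_of_subsingleton
    simp [this, subspaceMoebius]
  · have hpos : 0 < Module.finrank K V := by omega
    have : Nontrivial V := Module.finrank_pos_iff.1 hpos
    obtain ⟨v, hv⟩ := exists_ne (0 : V)
    set L := Submodule.span K {v} with hL
    have hvL : ∀ W : Submodule K V, v ∈ W ↔ L ≤ W := fun W => by simp [hL]
    rw [finsum_eq_sum_of_fintype, ← Finset.sum_fiberwise_of_maps_to
      (g := fun W : Submodule K V => W ⊔ L) (t := Finset.univ.filter fun W => L ≤ W) (by simp)]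
    -- In the fibre over `W` lie `W` itself and the complements of the line in `W`, which have one
    -- codimension more.
    have hfib : ∀ W ∈ Finset.univ.filter (fun W : Submodule K V => L ≤ W),
        ∑ H ∈ Finset.univ.filter (fun H => H ⊔ L = W),
          subspaceMoebius (Nat.card K) (Module.finrank K (V ⧸ H)) =
        (1 - (Nat.card K : ℤ) ^ (d - 1)) *
          subspaceMoebius (Nat.card K) (Module.finrank K (V ⧸ W)) := by
      intro W hW
      simp only [Finset.mem_filter, Finset.mem_univ, true_and] at hW
      have hvW : v ∈ W := (hvL W).2 hW
      rw [← Finset.sum_filter_add_sum_filter_not _ (fun H => v ∈ H)]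
      have e1 : (Finset.univ.filter (fun H => H ⊔ L = W)).filter (fun H => v ∈ H) = {W} := by
        ext H
        simp only [Finset.mem_filter, Finset.mem_univ, true_and, Finset.mem_singleton]
        constructor
        · rintro ⟨h1, h2⟩
          rwa [sup_eq_left.2 ((hvL H).1 h2)] at h1
        · rintro rfl
          exact ⟨sup_eq_left.2 hW, hvW⟩
      have hfin : ∀ H : Submodule K V, Module.finrank K (V ⧸ H) = d - Module.finrank K H := by
        intro H
        have := H.finrank_quotient_add_finrank
        omega
      have e2 : ∀ H ∈ (Finset.univ.filter (fun H => H ⊔ L = W)).filter (fun H => ¬ v ∈ H),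
          subspaceMoebius (Nat.card K) (Module.finrank K (V ⧸ H)) =
          subspaceMoebius (Nat.card K) (Module.finrank K (V ⧸ W) + 1) := by
        intro H hH
        simp only [Finset.mem_filter, Finset.mem_univ, true_and] at hH
        obtain ⟨h1, h2⟩ := hH
        congr 1
        have h3 := Submodule.finrank_sup_add_finrank_inf_eq H L
        have h4 : H ⊓ L = ⊥ := by
          rw [← disjoint_iff, Submodule.disjoint_span_singleton' hv]
          exact h2
        rw [h1, h4, finrank_bot, finrank_span_singleton hv] at h3
        have h5 := W.finrank_le
        rw [hfin, hfin]
        omega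
      have hcard : ((Finset.univ.filter (fun H => H ⊔ L = W)).filter (fun H => ¬ v ∈ H)).card =
          Nat.card K ^ (Module.finrank K W - 1) := by
        rw [← natCard_complement_line (W := W) (v := ⟨v, hvW⟩) (by simpa using hv),
          Nat.card_eq_fintype_card, Fintype.card_subtype, Finset.filter_filter]
      have hW1 : 1 ≤ Module.finrank K W := by
        rw [← finrank_span_singleton (K := K) hv]
        exact Submodule.finrank_mono hW
      have hW2 := W.finrank_le
      have hexp : d - 1 = (Module.finrank K W - 1) + (d - Module.finrank K W) := by omega
      rw [e1, Finset.sum_singleton, Finset.sum_congr rfl e2, Finset.sum_const, hcard,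
        subspaceMoebius_succ, hfin, hexp, pow_add, nsmul_eq_mul]
      push_cast
      ring
    rw [Finset.sum_congr rfl hfib, ← Finset.mul_sum]
    have h6 := finsum_subspaces_ge L (subspaceMoebius (Nat.card K))
    have h7 : Module.finrank K (V ⧸ L) = d - 1 := by
      have := L.finrank_quotient_add_finrank
      rw [finrank_span_singleton hv] at this
      omega
    rw [ih (d - 1) (by omega) h7, finsum_eq_sum_of_fintype] at h6
    rw [Finset.sum_subtype (p := fun W => L ≤ W) _ (by simp), h6]
    split_ifs with h8
    · simp [h8]
    · simp

/-- The Möbius function summed over an interval `[U, V]` of subspaces, grouped by codimension. -/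
theorem sum_subspaceMoebius_mul_natCard [Finite K] [Module.Finite K V] (U : Submodule K V) :
    ∑ j ∈ Finset.range (Module.finrank K V + 1), subspaceMoebius (Nat.card K) j *
      (Nat.card {W : Submodule K V // U ≤ W ∧ Module.finrank K (V ⧸ W) = j} : ℤ) =
      if U = ⊤ then 1 else 0 := by
  classical
  have : Finite V := Module.finite_of_finite K
  let _ := Fintype.ofFinite (Submodule K V)
  have h := finsum_subspaces_ge U (subspaceMoebius (Nat.card K))
  rw [finsum_subspaceMoebius, finsum_eq_sum_of_fintype] at h
  have h0 : Module.finrank K (V ⧸ U) = 0 ↔ U = ⊤ := by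
    rw [Module.finrank_zero_iff, Submodule.Quotient.subsingleton_iff]
  simp only [h0] at h
  rw [← h, ← Finset.sum_fiberwise_of_maps_to
      (g := fun W : {W : Submodule K V // U ≤ W} => Module.finrank K (V ⧸ W.1))
      (t := Finset.range (Module.finrank K V + 1))
      (fun W _ => Finset.mem_range.2 (Nat.lt_succ_of_le (Submodule.finrank_quotient_le W.1)))]
  refine Finset.sum_congr rfl fun j _ => ?_
  rw [Finset.sum_congr rfl (g := fun _ => subspaceMoebius (Nat.card K) j)
    (fun W hW => by rw [(Finset.mem_filter.1 hW).2]), Finset.sum_const, nsmul_eq_mul, mul_comm]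
  congr 2
  rw [← Fintype.card_subtype, ← Nat.card_eq_fintype_card]
  exact Nat.card_congr (Equiv.subtypeSubtypeEquivSubtypeInter (fun W => U ≤ W)
    (fun W => Module.finrank K (V ⧸ W) = j)).symm

end SubspaceSum

/-! ### Matrices modulo a prime element -/

section Automorphism

variable {K V : Type*} [Field K] [AddCommGroup V] [Module K V] [Module.Finite K V]

/-- Two subspaces of the same dimension differ by an automorphism of the space. -/
theorem Submodule.exists_linearEquiv_map_eq (D W : Submodule K V)
    (h : Module.finrank K D = Module.finrank K W) :
    ∃ e : V ≃ₗ[K] V, D.map (e : V →ₗ[K] V) = W := by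
  obtain ⟨D', hD⟩ := D.exists_isCompl
  obtain ⟨W', hW⟩ := W.exists_isCompl
  have h1 := Submodule.finrank_add_eq_of_isCompl hD
  have h2 := Submodule.finrank_add_eq_of_isCompl hW
  let e₁ : D ≃ₗ[K] W := LinearEquiv.ofFinrankEq _ _ h
  let e₂ : D' ≃ₗ[K] W' := LinearEquiv.ofFinrankEq _ _ (by omega)
  let e : V ≃ₗ[K] V := (Submodule.prodEquivOfIsCompl D D' hD).symm ≪≫ₗ (e₁.prodCongr e₂) ≪≫ₗ
    Submodule.prodEquivOfIsCompl W W' hW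
  have he : ∀ x : D, e x = e₁ x := fun x => by simp [e]
  refine ⟨e, le_antisymm ?_ fun w hw => ⟨e₁.symm ⟨w, hw⟩, (e₁.symm ⟨w, hw⟩).2, ?_⟩⟩
  · rintro _ ⟨x, hx, rfl⟩
    change e x ∈ W
    rw [he ⟨x, hx⟩]
    exact (e₁ ⟨x, hx⟩).2
  · change e _ = w
    rw [he]
    simp

end Automorphism

section Reduction

variable {n : ℕ} {R A k : Type*} [CommRing R] [CommRing A] [Field k]

/-- The diagonal matrix with `j` entries `ϖ`, followed by entries `1`. -/
def stepMatrix (n : ℕ) (ϖ : R) (j : ℕ) : Matrix (Fin n) (Fin n) R :=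
  Matrix.diagonal fun i => if (i : ℕ) < j then ϖ else 1

/-- The column space of the reduction of a square matrix. -/
noncomputable def columnSpace (ρ : R →+* k) (M : Matrix (Fin n) (Fin n) R) :
    Submodule k (Fin n → k) :=
  LinearMap.range (M.map ρ).mulVecLin

theorem columnSpace_mul (ρ : R →+* k) (M N : Matrix (Fin n) (Fin n) R) :
    columnSpace ρ (M * N) = (columnSpace ρ N).map (M.map ρ).mulVecLin := by
  rw [columnSpace, columnSpace, Matrix.map_mul, Matrix.mulVecLin_mul, LinearMap.range_comp]

theorem columnSpace_mul_le (ρ : R →+* k) (M N : Matrix (Fin n) (Fin n) R) :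
    columnSpace ρ (M * N) ≤ columnSpace ρ M := by
  rw [columnSpace_mul]
  exact LinearMap.map_le_range

theorem columnSpace_mul_unit (ρ : R →+* k) (M : Matrix (Fin n) (Fin n) R) (V : GL (Fin n) R) :
    columnSpace ρ (M * V.val) = columnSpace ρ M := by
  refine le_antisymm (columnSpace_mul_le _ _ _) ?_
  conv_lhs => rw [← mul_one M, ← V.mul_inv, ← mul_assoc]
  exact columnSpace_mul_le _ _ _

theorem stepMatrix_map {S : Type*} [CommRing S] (f : R →+* S) (ϖ : R) (j : ℕ) :
    (stepMatrix n ϖ j).map f = stepMatrix n (f ϖ) j := by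
  rw [stepMatrix, Matrix.diagonal_map (map_zero f), stepMatrix]
  congr 1
  ext i
  split_ifs <;> simp

theorem mem_columnSpace_stepMatrix {ρ : R →+* k} {ϖ : R} (hϖ : ρ ϖ = 0) (j : ℕ) (w : Fin n → k) :
    w ∈ columnSpace ρ (stepMatrix n ϖ j) ↔ ∀ i : Fin n, (i : ℕ) < j → w i = 0 := by
  rw [columnSpace, stepMatrix_map, hϖ, stepMatrix]
  constructor
  · rintro ⟨u, rfl⟩ i hi
    simp [Matrix.mulVec_diagonal, hi]
  · intro hw
    refine ⟨w, funext fun i => ?_⟩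
    by_cases hi : (i : ℕ) < j
    · simp [Matrix.mulVec_diagonal, hi, hw i hi]
    · simp [Matrix.mulVec_diagonal, hi]

/-- A matrix of the form `U D V`, with `U`, `V` invertible and `D = diag(ϖ, …, ϖ, 1, …, 1)`, divides
`M` on the left as soon as the reduction modulo `ϖ` does. -/
theorem exists_eq_mul_iff_columnSpace_le {ρ : R →+* k} {ϖ : R} (hϖ : ∀ a, ρ a = 0 ↔ ϖ ∣ a) {j : ℕ}
    {Y : Matrix (Fin n) (Fin n) R} {U V : GL (Fin n) R}
    (hY : Y = U.val * stepMatrix n ϖ j * V.val) (M : Matrix (Fin n) (Fin n) R) :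
    (∃ N, M = Y * N) ↔ columnSpace ρ M ≤ columnSpace ρ Y := by
  constructor
  · rintro ⟨N, rfl⟩
    exact columnSpace_mul_le _ _ _
  · intro h
    have hρ : ρ ϖ = 0 := (hϖ ϖ).2 dvd_rfl
    have h1 : columnSpace ρ (U⁻¹.val * M) ≤ columnSpace ρ (stepMatrix n ϖ j) := by
      rw [columnSpace_mul]
      refine (Submodule.map_mono h).trans ?_
      rw [← columnSpace_mul, hY, ← mul_assoc, columnSpace_mul_unit, ← mul_assoc, Units.inv_mul,
        one_mul]
    have h2 : ∀ i c : Fin n, (i : ℕ) < j → ϖ ∣ (U⁻¹.val * M) i c := by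
      intro i c hi
      rw [← hϖ]
      have := (mem_columnSpace_stepMatrix hρ j _).1
        (h1 (LinearMap.mem_range_self _ (Pi.single c 1))) i hi
      rwa [Matrix.mulVecLin_apply, Matrix.mulVec_single_one] at this
    choose q hq using h2
    refine ⟨V⁻¹.val * Matrix.of fun i c : Fin n => if h : (i : ℕ) < j then q i c h else (U⁻¹.val * M) i c, ?_⟩
    have h3 : stepMatrix n ϖ j *
        (Matrix.of fun i c : Fin n => if h : (i : ℕ) < j then q i c h else (U⁻¹.val * M) i c) =
        U⁻¹.val * M := by
      ext i c
      rw [stepMatrix, Matrix.diagonal_mul, Matrix.of_apply]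
      split_ifs with hi
      · exact (hq i c hi).symm
      · rw [one_mul]
    rw [hY, mul_assoc, ← mul_assoc V.val, Units.mul_inv, one_mul, mul_assoc, h3, ← mul_assoc,
      Units.mul_inv, one_mul]

theorem finrank_columnSpace_unit_mul (ρ : R →+* k) (U : GL (Fin n) R) (M : Matrix (Fin n) (Fin n) R) :
    Module.finrank k (columnSpace ρ (U.val * M)) = Module.finrank k (columnSpace ρ M) := by
  refine le_antisymm ?_ ?_
  · rw [columnSpace_mul]
    exact Submodule.finrank_map_le _ _
  · conv_lhs => rw [← one_mul M, ← U.inv_mul, mul_assoc, columnSpace_mul]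
    exact Submodule.finrank_map_le _ _

theorem finrank_columnSpace_stepMatrix {ρ : R →+* k} {ϖ : R} (hϖ : ρ ϖ = 0) {j : ℕ} :
    Module.finrank k (columnSpace ρ (stepMatrix n ϖ j)) = n - j := by
  classical
  rw [columnSpace, stepMatrix_map, hϖ, stepMatrix]
  refine (Matrix.rank_diagonal _).trans ?_
  have h : ∀ i : Fin n, (if (i : ℕ) < j then (0 : k) else 1) ≠ 0 ↔ ¬ (i : ℕ) < j := fun i => by
    split_ifs with hi <;> simp [hi]
  rw [Fintype.card_congr (Equiv.subtypeEquivRight h), Fintype.card_subtype_compl, Fintype.card_fin,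
    Fintype.card_subtype, Fin.card_filter_val_lt]
  omega

theorem finrank_quotient_columnSpace {ρ : R →+* k} {ϖ : R} (hϖ : ρ ϖ = 0) {j : ℕ} (hj : j ≤ n)
    (U V : GL (Fin n) R) : Module.finrank k ((Fin n → k) ⧸
      columnSpace ρ (U.val * stepMatrix n ϖ j * V.val)) = j := by
  have h1 := (columnSpace ρ (U.val * stepMatrix n ϖ j * V.val)).finrank_quotient_add_finrank
  have h2 : Module.finrank k (columnSpace ρ (U.val * stepMatrix n ϖ j * V.val)) = n - j := by
    rw [columnSpace_mul_unit, finrank_columnSpace_unit_mul, finrank_columnSpace_stepMatrix hϖ]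
  rw [Module.finrank_fin_fun] at h1
  omega

/-- Every subspace of codimension `j` is the column space of some `U diag(ϖ, …, ϖ, 1, …, 1)`. -/
theorem exists_columnSpace_eq {ρ : R →+* k} {ϖ : R} (hϖ : ρ ϖ = 0)
    (hρ : Function.Surjective (Matrix.GeneralLinearGroup.map (n := Fin n) ρ)) {j : ℕ}
    (W : Submodule k (Fin n → k)) (hW : Module.finrank k ((Fin n → k) ⧸ W) = j) :
    ∃ U : GL (Fin n) R, columnSpace ρ (U.val * stepMatrix n ϖ j) = W := by
  have h1 := W.finrank_quotient_add_finrank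
  rw [Module.finrank_fin_fun] at h1
  obtain ⟨e, he⟩ := Submodule.exists_linearEquiv_map_eq (columnSpace ρ (stepMatrix n ϖ j)) W
    (by rw [finrank_columnSpace_stepMatrix hϖ]; omega)
  obtain ⟨U, hU⟩ := hρ (Matrix.GeneralLinearGroup.toLin.symm
    (LinearMap.GeneralLinearGroup.ofLinearEquiv e))
  refine ⟨U, ?_⟩
  rw [columnSpace_mul, ← he]
  congr 1
  have h2 : U.val.map ρ = LinearMap.toMatrix' (e : (Fin n → k) →ₗ[k] (Fin n → k)) := by
    have := congrArg Units.val hU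
    exact this
  rw [h2, ← Matrix.toLin'_apply', Matrix.toLin'_toMatrix']

end Reduction

/-! ### Elementary divisors -/

section ElementaryDivisors

variable {n : ℕ}

/-- The Smith normal form of a matrix with nonzero determinant, read off from adapted bases of the
free module and of the submodule spanned by the columns. -/
theorem exists_eq_unit_mul_diagonal_mul_unit {O : Type*} [CommRing O] [IsDomain O]
    [IsPrincipalIdealRing O] {M : Matrix (Fin n) (Fin n) O} (hM : M.det ≠ 0) :
    ∃ (U V : GL (Fin n) O) (d : Fin n → O), M = U.val * Matrix.diagonal d * V.val := by
  have hinj : Function.Injective M.mulVecLin := Matrix.mulVec_injective_of_det_ne_zero hM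
  let e := LinearEquiv.ofInjective _ hinj
  obtain ⟨b, d, c, hbc⟩ := Submodule.exists_smith_normal_form_of_rank_eq (Pi.basisFun O (Fin n))
    e.finrank_eq.symm
  let m := (Pi.basisFun O (Fin n)).map e
  let U : GL (Fin n) O := ⟨(Pi.basisFun O (Fin n)).toMatrix b, b.toMatrix (Pi.basisFun O (Fin n)),
    Module.Basis.toMatrix_mul_toMatrix_flip _ _, Module.Basis.toMatrix_mul_toMatrix_flip _ _⟩
  let V : GL (Fin n) O := ⟨c.toMatrix m, m.toMatrix c,
    Module.Basis.toMatrix_mul_toMatrix_flip _ _, Module.Basis.toMatrix_mul_toMatrix_flip _ _⟩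
  refine ⟨U, V, d, ?_⟩
  ext i j
  have h1 : ∑ l, c.toMatrix m l j • c l = m j := c.sum_toMatrix_smul_self m j
  have h2 := congrFun (congrArg Subtype.val h1) i
  have h3 : (m j : Fin n → O) i = M i j := by simp [m, e]
  rw [h3] at h2
  rw [← h2, Matrix.mul_apply]
  simp only [AddSubmonoidClass.coe_finsetSum, Submodule.coe_smul, hbc, Finset.sum_apply,
    Pi.smul_apply, smul_eq_mul, Matrix.mul_diagonal]
  refine Finset.sum_congr rfl fun l _ => ?_
  simp only [U, V, Module.Basis.toMatrix_apply (Pi.basisFun O (Fin n)), Pi.basisFun_repr]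
  ring

/-- The elementary divisors of a matrix over a principal ideal domain may be ordered by the values
of any function. -/
theorem exists_eq_unit_mul_diagonal_mul_unit_monotone {O Γ : Type*} [CommRing O] [IsDomain O]
    [IsPrincipalIdealRing O] [LinearOrder Γ] (f : O → Γ) {M : Matrix (Fin n) (Fin n) O}
    (hM : M.det ≠ 0) :
    ∃ (U V : GL (Fin n) O) (d : Fin n → O), Monotone (f ∘ d) ∧
      M = U.val * Matrix.diagonal d * V.val := by
  obtain ⟨U, V, d, h⟩ := exists_eq_unit_mul_diagonal_mul_unit hM
  let σ := Tuple.sort (f ∘ d)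
  have hσ : ∀ τ : Equiv.Perm (Fin n), (τ.permMatrix O) * ((τ⁻¹).permMatrix O) = 1 := fun τ => by
    rw [← Matrix.permMatrix_mul]; simp
  let P : GL (Fin n) O := ⟨σ.permMatrix O, (σ⁻¹).permMatrix O, hσ σ, by simpa using hσ σ⁻¹⟩
  refine ⟨U * P⁻¹, P * V, d ∘ σ, Tuple.monotone_sort (f ∘ d), ?_⟩
  have h2 : P.val * Matrix.diagonal d = Matrix.diagonal (d ∘ σ) * P.val := by
    ext i j
    rw [Matrix.mul_diagonal, Matrix.diagonal_mul]
    simp only [P, Equiv.Perm.permMatrix, Equiv.toPEquiv_apply, PEquiv.toMatrix_apply,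
      Option.mem_def, Option.some.injEq, Function.comp]
    split_ifs with hij
    · rw [hij, mul_comm]
    · simp
  have h3 : Matrix.diagonal d = P⁻¹.val * Matrix.diagonal (d ∘ σ) * P.val := by
    rw [mul_assoc, ← h2, ← mul_assoc, Units.inv_mul, one_mul]
  rw [h, h3, Units.val_mul, Units.val_mul]
  simp only [mul_assoc]

/-- If `U diag(a) = diag(b) W` with `U` integral and `W` invertible over the integers, then the
elementary divisors `a` divide the elementary divisors `b` one by one. Otherwise `W` would have,
modulo the maximal ideal, a zero block too large for an invertible matrix. -/
theorem valuation_le_of_mul_diagonal_eq {L Γ : Type*} [Field L]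
    [LinearOrderedCommGroupWithZero Γ] (v : Valuation L Γ) {a b : Fin n → L}
    (ha : Monotone (v ∘ a)) (hb' : Monotone (v ∘ b))
    {U W : Matrix (Fin n) (Fin n) L} (hU : ∀ i j, v (U i j) ≤ 1) (hW : ∀ i j, v (W i j) ≤ 1)
    (hdet : v W.det = 1) (h : U * Matrix.diagonal a = Matrix.diagonal b * W) (i : Fin n) :
    v (b i) ≤ v (a i) := by
  by_contra! hlt
  have hsmall : ∀ p q, q ≤ i → i ≤ p → v (W p q) < 1 := by
    intro p q hq hp
    have h1 : U p q * a q = b p * W p q := by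
      have := congrFun (congrFun h p) q
      rwa [Matrix.mul_diagonal, Matrix.diagonal_mul] at this
    have h2 : v (b p) * v (W p q) < v (b p) * 1 := by
      rw [← map_mul, ← h1, map_mul, mul_one]
      calc v (U p q) * v (a q) ≤ 1 * v (a q) := by gcongr; exact hU p q
        _ = v (a q) := one_mul _
        _ ≤ v (a i) := ha hq
        _ < v (b i) := hlt
        _ ≤ v (b p) := hb' hp
    exact lt_of_mul_lt_mul_left' h2
  -- The zero block has rows `≥ i` and columns `≤ i`, and every permutation meets it.
  have hperm : ∀ σ : Equiv.Perm (Fin n), ∃ q, q ≤ i ∧ i ≤ σ q := by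
    intro σ
    by_contra! hσ
    have := Finset.card_le_card_of_injOn σ (s := Finset.Iic i) (t := Finset.Iio i)
      (fun q hq => by simpa using hσ q (by simpa using hq)) σ.injective.injOn
    rw [Fin.card_Iic, Fin.card_Iio] at this
    omega
  have hlt1 : v W.det < 1 := by
    rw [Matrix.det_apply]
    refine v.map_sum_lt one_ne_zero fun σ _ => ?_
    have h1 : v (Equiv.Perm.sign σ • ∏ j, W (σ j) j) = ∏ j, v (W (σ j) j) := by
      rw [← map_prod]
      rcases Int.units_eq_one_or (Equiv.Perm.sign σ) with hs | hs <;> simp [hs]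
    obtain ⟨q, hq1, hq2⟩ := hperm σ
    rw [h1, ← Finset.mul_prod_erase _ _ (Finset.mem_univ q)]
    calc v (W (σ q) q) * ∏ j ∈ Finset.univ.erase q, v (W (σ j) j)
        ≤ v (W (σ q) q) * 1 := by
          gcongr
          exact Finset.prod_le_one' fun j _ => hW _ _
      _ < 1 := by rw [mul_one]; exact hsmall _ _ hq1 hq2
  exact hlt1.ne hdet

end ElementaryDivisors

/-! ### Cosets and subspaces -/

section CosetCount

variable {n : ℕ} {R A k : Type*} [CommRing R] [CommRing A] [Field k] {ι : R →+* A} {ρ : R →+* k}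
  {ϖ : R} {j : ℕ} {δ : GL (Fin n) A}

theorem mem_doubleCoset_range_iff (hδ : δ.val = (stepMatrix n ϖ j).map ι) (y : GL (Fin n) A) :
    y ∈ DoubleCoset.doubleCoset δ
        ((Matrix.GeneralLinearGroup.map (n := Fin n) ι).range : Set (GL (Fin n) A))
        ((Matrix.GeneralLinearGroup.map (n := Fin n) ι).range : Set (GL (Fin n) A)) ↔
      ∃ U V : GL (Fin n) R, y.val = (U.val * stepMatrix n ϖ j * V.val).map ι := by
  rw [DoubleCoset.mem_doubleCoset]
  constructor
  · rintro ⟨_, ⟨U, rfl⟩, _, ⟨V, rfl⟩, rfl⟩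
    refine ⟨U, V, ?_⟩
    rw [Matrix.map_mul, Matrix.map_mul, ← hδ]
    rfl
  · rintro ⟨U, V, h⟩
    refine ⟨_, ⟨U, rfl⟩, _, ⟨V, rfl⟩, Units.ext ?_⟩
    rw [h, Matrix.map_mul, Matrix.map_mul, ← hδ]
    rfl

/-- The cosets `y GL_n(R)` in the double coset of `diag(ϖ, …, ϖ, 1, …, 1)` that divide an integral
matrix `M` on the left correspond to the subspaces of codimension `j` that contain the column space
of `M` modulo `ϖ`. -/
theorem natCard_cosets_eq_natCard_subspaces (hι : Function.Injective ι)
    (hϖ : ∀ a, ρ a = 0 ↔ ϖ ∣ a)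
    (hρ : Function.Surjective (Matrix.GeneralLinearGroup.map (n := Fin n) ρ)) (hj : j ≤ n)
    (hδ : δ.val = (stepMatrix n ϖ j).map ι) {g : GL (Fin n) A} {M : Matrix (Fin n) (Fin n) R}
    (hM : g.val = M.map ι) :
    Nat.card {y : GL (Fin n) A ⧸ (Matrix.GeneralLinearGroup.map (n := Fin n) ι).range //
      y.out ∈ DoubleCoset.doubleCoset δ
        ((Matrix.GeneralLinearGroup.map (n := Fin n) ι).range : Set (GL (Fin n) A))
        ((Matrix.GeneralLinearGroup.map (n := Fin n) ι).range : Set (GL (Fin n) A)) ∧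
      ∃ N : Matrix (Fin n) (Fin n) R, (y.out⁻¹ * g).val = N.map ι} =
    Nat.card {W : Submodule k (Fin n → k) // columnSpace ρ M ≤ W ∧
      Module.finrank k ((Fin n → k) ⧸ W) = j} := by
  have hρϖ : ρ ϖ = 0 := (hϖ ϖ).2 dvd_rfl
  have hmap : Function.Injective fun M : Matrix (Fin n) (Fin n) R => M.map ι :=
    Matrix.map_injective hι
  have hdiv : ∀ {y g : GL (Fin n) A} {Y M N : Matrix (Fin n) (Fin n) R}, y.val = Y.map ι →
      g.val = M.map ι → ((y⁻¹ * g).val = N.map ι ↔ M = Y * N) := by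
    intro y g Y M N hY hM
    rw [← hmap.eq_iff, Matrix.map_mul, ← hM, ← hY]
    constructor
    · intro h
      rw [← h, ← Units.val_mul, mul_inv_cancel_left]
    · intro h
      rw [Units.val_mul, h, ← mul_assoc, Units.inv_mul, one_mul]
  simp only [mem_doubleCoset_range_iff hδ]
  have hex : ∀ y : {y : GL (Fin n) A ⧸ (Matrix.GeneralLinearGroup.map (n := Fin n) ι).range //
      (∃ U V : GL (Fin n) R, y.out.val = (U.val * stepMatrix n ϖ j * V.val).map ι) ∧
      ∃ N : Matrix (Fin n) (Fin n) R, (y.out⁻¹ * g).val = N.map ι},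
      ∃ Y : Matrix (Fin n) (Fin n) R, y.1.out.val = Y.map ι ∧
        ∃ U V : GL (Fin n) R, Y = U.val * stepMatrix n ϖ j * V.val := by
    rintro ⟨y, ⟨U, V, h⟩, -⟩
    exact ⟨_, h, U, V, rfl⟩
  choose Y hY hUV using hex
  refine Nat.card_eq_of_bijective (fun y => ⟨columnSpace ρ (Y y), ?_, ?_⟩) ⟨?_, ?_⟩
  · obtain ⟨N, hN⟩ := y.2.2
    rw [(hdiv (hY y) hM).1 hN]
    exact columnSpace_mul_le _ _ _
  · obtain ⟨U, V, h⟩ := hUV y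
    rw [h]
    exact finrank_quotient_columnSpace hρϖ hj U V
  · intro y z hyz
    have hyz' : columnSpace ρ (Y y) = columnSpace ρ (Y z) := Subtype.ext_iff.1 hyz
    obtain ⟨U, V, h⟩ := hUV y
    obtain ⟨U', V', h'⟩ := hUV z
    obtain ⟨N, hN⟩ := (exists_eq_mul_iff_columnSpace_le hϖ h _).2 hyz'.ge
    obtain ⟨N', hN'⟩ := (exists_eq_mul_iff_columnSpace_le hϖ h' _).2 hyz'.le
    have e := (hdiv (hY y) (hY z)).2 hN
    have e' := (hdiv (hY z) (hY y)).2 hN'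
    have hone : ∀ {P Q : Matrix (Fin n) (Fin n) R} {a b : GL (Fin n) A}, a.val = P.map ι →
        b.val = Q.map ι → a * b = 1 → P * Q = 1 := by
      intro P Q a b ha hb hab
      apply hmap
      change (P * Q).map ι = (1 : Matrix _ _ _).map ι
      rw [Matrix.map_mul, ← ha, ← hb, ← Units.val_mul, hab, Matrix.map_one _ (map_zero ι) (map_one ι)]
      rfl
    refine Subtype.ext ?_
    rw [← QuotientGroup.out_eq' y.1, ← QuotientGroup.out_eq' z.1]
    exact QuotientGroup.eq.2 ⟨⟨N, N', hone e e' (by group), hone e' e (by group)⟩, Units.ext e.symm⟩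
  · rintro ⟨W, hW1, hW2⟩
    obtain ⟨U, hU⟩ := exists_columnSpace_eq hρϖ hρ W hW2
    set y₀ : GL (Fin n) A := Matrix.GeneralLinearGroup.map ι U * δ with hy₀
    obtain ⟨⟨_, V, rfl⟩, hV⟩ := QuotientGroup.mk_out_eq_mul
      (Matrix.GeneralLinearGroup.map (n := Fin n) ι).range y₀
    have hval : (QuotientGroup.mk y₀ : GL (Fin n) A ⧸
        (Matrix.GeneralLinearGroup.map (n := Fin n) ι).range).out.val =
        (U.val * stepMatrix n ϖ j * V.val).map ι := by
      rw [hV, Matrix.map_mul, Matrix.map_mul, ← hδ]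
      rfl
    have hcol : columnSpace ρ (U.val * stepMatrix n ϖ j * V.val) = W := by
      rw [columnSpace_mul_unit, hU]
    obtain ⟨N, hN⟩ := (exists_eq_mul_iff_columnSpace_le hϖ (U := U) (V := V) (j := j) rfl M).2
      (hW1.trans hcol.ge)
    refine ⟨⟨QuotientGroup.mk y₀, ⟨U, V, hval⟩, N, (hdiv hval hM).2 hN⟩, Subtype.ext ?_⟩
    exact (congrArg (columnSpace ρ) (hmap ((hY _).symm.trans hval))).trans hcol

end CosetCount

/-! ### Adeles without poles and their reductions -/

section LocalReduction

variable {F : Type*} [Field F] {I : Ideal F[X]} {n : ℕ}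

/-- The component at `x` of an adele without poles, as a ring homomorphism. -/
noncomputable def integralEval (x : Place F I) : integralAdeles F I →+* x.Integers :=
  ((RestrictedProduct.evalRingHom (fun y : Place F I => y.Completion) x).comp
    (integralAdeles F I).subtype).codRestrict x.Integers fun a => a.2 x

theorem coe_integralEval (x : Place F I) (a : integralAdeles F I) :
    (integralEval x a : x.Completion) = a.1 x := rfl

theorem integralAdeles_ext {a b : integralAdeles F I}
    (h : ∀ x, integralEval x a = integralEval x b) : a = b :=
  Subtype.ext (RestrictedProduct.ext _ _ fun x => congrArg Subtype.val (h x))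

/-- The adele without poles with given integral components. -/
noncomputable def integralAdeleMk (a : ∀ x : Place F I, x.Integers) : integralAdeles F I :=
  ⟨⟨fun x => (a x : x.Completion), Filter.Eventually.of_forall fun x => (a x).2⟩, fun x => (a x).2⟩

/-- The matrix over the adeles without poles with given integral components. -/
noncomputable def integralMatrixMk (M : ∀ x : Place F I, Matrix (Fin n) (Fin n) x.Integers) :
    Matrix (Fin n) (Fin n) (integralAdeles F I) :=
  Matrix.of fun i j => integralAdeleMk fun x => M x i j

theorem integralMatrixMk_map (M : ∀ x : Place F I, Matrix (Fin n) (Fin n) x.Integers)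
    (x : Place F I) : (integralMatrixMk M).map (integralEval x) = M x := rfl

theorem integralMatrix_ext {M N : Matrix (Fin n) (Fin n) (integralAdeles F I)}
    (h : ∀ x, M.map (integralEval x) = N.map (integralEval x)) : M = N := by
  refine Matrix.ext fun i j => ?_
  exact integralAdeles_ext fun x => congrFun (congrFun (h x) i) j

/-- The element of `GL_n(O^S)` with given components in `GL_n(O_x)`. -/
noncomputable def integralGLMk (U : ∀ x : Place F I, GL (Fin n) x.Integers) :
    GL (Fin n) (integralAdeles F I) where
  val := integralMatrixMk fun x => (U x).val
  inv := integralMatrixMk fun x => (U x)⁻¹.val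
  val_inv := integralMatrix_ext fun x => by
    rw [Matrix.map_mul, integralMatrixMk_map, integralMatrixMk_map, Units.mul_inv,
      Matrix.map_one _ (map_zero _) (map_one _)]
  inv_val := integralMatrix_ext fun x => by
    rw [Matrix.map_mul, integralMatrixMk_map, integralMatrixMk_map, Units.inv_mul,
      Matrix.map_one _ (map_zero _) (map_one _)]

/-- Reduction of adeles without poles at `x`. -/
noncomputable def residueAt (x : Place F I) :
    integralAdeles F I →+* IsLocalRing.ResidueField x.Integers :=
  (IsLocalRing.residue x.Integers).comp (integralEval x)

theorem IsLocalRing.surjective_generalLinearGroup_map_residue (O : Type*) [CommRing O]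
    [IsLocalRing O] : Function.Surjective
      (Matrix.GeneralLinearGroup.map (n := Fin n) (IsLocalRing.residue O)) := by
  intro h
  choose f hf using IsLocalRing.residue_surjective (R := O)
  let M : Matrix (Fin n) (Fin n) O := h.val.map f
  have hM : M.map (IsLocalRing.residue O) = h.val := by
    ext i j
    exact hf _
  have hdet : IsUnit M.det := by
    rw [← isUnit_map_iff (IsLocalRing.residue O), RingHom.map_det, RingHom.mapMatrix_apply, hM]
    exact (Matrix.isUnit_iff_isUnit_det _).1 h.isUnit
  refine ⟨Matrix.GeneralLinearGroup.mk'' M hdet, Units.ext ?_⟩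
  exact hM

/-- A lift from the residue field at `x` may be taken equal to `1` at all other places. -/
theorem surjective_generalLinearGroup_map_residueAt (x : Place F I) :
    Function.Surjective (Matrix.GeneralLinearGroup.map (n := Fin n) (residueAt x)) := by
  classical
  intro h
  obtain ⟨U, hU⟩ := IsLocalRing.surjective_generalLinearGroup_map_residue x.Integers h
  refine ⟨integralGLMk (Function.update (fun _ => 1) x U), Units.ext ?_⟩
  rw [← hU]
  ext i j
  change IsLocalRing.residue _ ((Function.update (fun _ => 1) x U :
    ∀ y : Place F I, GL (Fin n) y.Integers) x i j) = _
  rw [Function.update_self]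
  rfl

theorem residueAt_eq_zero_iff (x : Place F I) (a : integralAdeles F I) :
    residueAt x a = 0 ↔ Valued.v (a.1 x) < 1 := by
  rw [residueAt, RingHom.comp_apply, IsLocalRing.residue_eq_zero_iff]
  exact Valuation.mem_maximalIdeal_iff _ _

theorem localIdele_apply_same (x : Place F I) (t : x.Completionˣ) :
    (localIdele x t).val x = t := by
  classical exact RestrictedProduct.mulSingle_eq_same ..

theorem localIdele_apply_of_ne {x y : Place F I} (t : x.Completionˣ) (h : y ≠ x) :
    (localIdele x t).val y = 1 := by
  classical exact RestrictedProduct.mulSingle_eq_of_ne _ _ h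

theorem Place.IsUniformizer.localIdele_mem {x : Place F I} {t : x.Completionˣ}
    (ht : x.IsUniformizer t) : (localIdele x t).val ∈ integralAdeles F I := by
  intro y
  by_cases h : y = x
  · subst h
    rw [localIdele_apply_same, HeightOneSpectrum.mem_adicCompletionIntegers, ht,
      ← WithZero.exp_zero, WithZero.exp_le_exp]
    norm_num
  · rw [localIdele_apply_of_ne t h]
    exact one_mem _

theorem residueAt_eq_zero_iff_dvd {x : Place F I} {t : x.Completionˣ} (ht : x.IsUniformizer t)
    (a : integralAdeles F I) : residueAt x a = 0 ↔ ⟨_, ht.localIdele_mem⟩ ∣ a := by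
  have h0 : residueAt x ⟨_, ht.localIdele_mem⟩ = 0 := by
    rw [residueAt_eq_zero_iff]
    change Valued.v ((localIdele x t).val x) < 1
    rw [localIdele_apply_same, ht, ← WithZero.exp_zero, WithZero.exp_lt_exp]
    norm_num
  constructor
  · intro h
    rw [residueAt_eq_zero_iff] at h
    refine ⟨⟨(localIdele x t)⁻¹.val * a.1, fun y => ?_⟩, Subtype.ext ?_⟩
    · have hy : ((localIdele x t)⁻¹.val * a.1) y = ((localIdele x t).val y)⁻¹ * a.1 y := by
        have h1 : ((localIdele x t).val * (localIdele x t)⁻¹.val) y = 1 := by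
          rw [Units.mul_inv]; rfl
        rw [RestrictedProduct.mul_apply] at h1 ⊢
        rw [eq_inv_of_mul_eq_one_right h1]
      rw [hy]
      by_cases hyx : y = x
      · subst hyx
        rw [localIdele_apply_same, HeightOneSpectrum.mem_adicCompletionIntegers, map_mul, map_inv₀,
          ht, ← WithZero.exp_neg, neg_neg]
        by_cases ha : Valued.v (a.1 y) = 0
        · rw [ha, mul_zero]
          exact zero_le
        · rw [← WithZero.exp_log ha] at h ⊢
          rw [← WithZero.exp_zero, WithZero.exp_lt_exp] at h
          rw [← WithZero.exp_add, ← WithZero.exp_zero, WithZero.exp_le_exp]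
          omega
      · rw [localIdele_apply_of_ne t hyx, inv_one, one_mul]
        exact a.2 y
    · exact ((localIdele x t).mul_inv_cancel_left a.1).symm
  · rintro ⟨b, rfl⟩
    rw [map_mul, h0, zero_mul]

/-- The residue field of the completion at `x` has `q_x` elements. -/
theorem natCard_residueField (x : Place F I) :
    Nat.card (IsLocalRing.ResidueField x.Integers) = x.residueCard := by
  let v := x.1
  let K := RatFunc F
  let f : F[X] →+* IsLocalRing.ResidueField (v.adicCompletionIntegers K) :=
    (IsLocalRing.residue _).comp (algebraMap F[X] (v.adicCompletionIntegers K))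
  have hf : ∀ a, f a = 0 ↔ a ∈ v.asIdeal := by
    intro a
    change IsLocalRing.residue _ _ = 0 ↔ _
    rw [IsLocalRing.residue_eq_zero_iff]
    refine (Valuation.mem_maximalIdeal_iff _ _).trans ?_
    change Valued.v (algebraMap F[X] (v.adicCompletion K) a) < 1 ↔ _
    rw [← v.valuation_lt_one_iff_mem (K := K) a]
    exact iff_of_eq (congrArg (· < 1) (v.valuedAdicCompletion_eq_valuation a))
  have hs : Function.Surjective f := by
    intro y
    obtain ⟨z, rfl⟩ := IsLocalRing.residue_surjective y
    obtain ⟨k, hk⟩ : ∃ k : K, Valued.v ((k : v.adicCompletion K) - z) < 1 := by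
      have hn : {w : v.adicCompletion K | Valued.v (w - z) < 1} ∈ nhds (z : v.adicCompletion K) :=
        (Valued.mem_nhds (R := v.adicCompletion K)).2 ⟨1, by simp⟩
      obtain ⟨_, hk, k, rfl⟩ := mem_closure_iff_nhds.1
        (HeightOneSpectrum.denseRange_algebraMap K v (z : v.adicCompletion K)) _ hn
      exact ⟨k, hk⟩
    have hk1 : v.valuation K k ≤ 1 := by
      rw [← HeightOneSpectrum.valuedAdicCompletion_eq_valuation']
      have := Valued.v.map_add ((k : v.adicCompletion K) - z) z
      rw [sub_add_cancel] at this
      exact this.trans (max_le hk.le z.2)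
    obtain ⟨a, ha⟩ := v.exists_valuation_sub_lt_of_integer hk1 1
    refine ⟨a, ?_⟩
    rw [← sub_eq_zero]
    change IsLocalRing.residue _ (algebraMap F[X] (v.adicCompletionIntegers K) a) - _ = 0
    rw [← map_sub, IsLocalRing.residue_eq_zero_iff]
    refine (Valuation.mem_maximalIdeal_iff _ _).2 ?_
    change Valued.v (((algebraMap F[X] K a : K) : v.adicCompletion K) - z) < 1
    have ha' : Valued.v (((algebraMap F[X] K a : K) : v.adicCompletion K) - k) < 1 := by
      rw [Units.val_one, ← HeightOneSpectrum.valuedAdicCompletion_eq_valuation'] at ha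
      have h1 : ((algebraMap F[X] K a - k : K) : v.adicCompletion K) =
          ((algebraMap F[X] K a : K) : v.adicCompletion K) - k :=
        map_sub (algebraMap K (v.adicCompletion K)) _ _
      rwa [h1] at ha
    have := Valued.v.map_add (((algebraMap F[X] K a : K) : v.adicCompletion K) - k) (k - z)
    rw [sub_add_sub_cancel] at this
    exact this.trans_lt (max_lt ha' hk)
  have hker : RingHom.ker f = x.1.asIdeal := Ideal.ext fun a => hf a
  rw [Place.residueCard, ← hker]
  exact (Nat.card_congr (RingHom.quotientKerEquivOfSurjective hs).toEquiv).symm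

end LocalReduction

/-! ### Orders and degrees of ideles -/

section Order

variable {F : Type*} [Field F] {I : Ideal F[X]} {n : ℕ}

/-- The order of an idele outside `S` at `x`. -/
noncomputable def ideleOrder (x : Place F I) (a : (AdeleOutside F I)ˣ) : ℤ :=
  -WithZero.log (Valued.v (a.val x))

theorem idele_mul_inv_apply (a : (AdeleOutside F I)ˣ) (x : Place F I) :
    a.val x * a⁻¹.val x = 1 := by
  rw [← RestrictedProduct.mul_apply, Units.mul_inv]
  rfl

theorem idele_apply_ne_zero (a : (AdeleOutside F I)ˣ) (x : Place F I) : a.val x ≠ 0 :=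
  left_ne_zero_of_mul_eq_one (idele_mul_inv_apply a x)

theorem valued_idele (a : (AdeleOutside F I)ˣ) (x : Place F I) :
    Valued.v (a.val x) = WithZero.exp (-ideleOrder x a) := by
  rw [ideleOrder, neg_neg, WithZero.exp_log]
  exact (Valuation.ne_zero_iff _).2 (idele_apply_ne_zero a x)

theorem ideleOrder_eq_iff (x : Place F I) (a : (AdeleOutside F I)ˣ) (m : ℤ) :
    ideleOrder x a = m ↔ Valued.v (a.val x) = WithZero.exp (-m) := by
  rw [valued_idele, WithZero.exp_inj, neg_inj]

theorem ideleOrder_mul (x : Place F I) (a b : (AdeleOutside F I)ˣ) :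
    ideleOrder x (a * b) = ideleOrder x a + ideleOrder x b := by
  rw [ideleOrder_eq_iff, Units.val_mul, RestrictedProduct.mul_apply, map_mul, valued_idele,
    valued_idele, ← WithZero.exp_add, neg_add]

theorem ideleOrder_one (x : Place F I) : ideleOrder x (1 : (AdeleOutside F I)ˣ) = 0 := by
  rw [ideleOrder_eq_iff, neg_zero, WithZero.exp_zero]
  exact map_one _

theorem mem_integralAdeles_iff (a : (AdeleOutside F I)ˣ) :
    a.val ∈ integralAdeles F I ↔ ∀ x, 0 ≤ ideleOrder x a := by
  refine forall_congr' fun x => ?_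
  rw [HeightOneSpectrum.mem_adicCompletionIntegers, valued_idele, ← WithZero.exp_zero,
    WithZero.exp_le_exp, neg_nonpos]

theorem ideleOrder_inv (x : Place F I) (a : (AdeleOutside F I)ˣ) :
    ideleOrder x a⁻¹ = -ideleOrder x a := by
  have := ideleOrder_mul x a a⁻¹
  rw [mul_inv_cancel, ideleOrder_one] at this
  omega

theorem finite_ideleOrder_ne_zero (a : (AdeleOutside F I)ˣ) :
    {x | ideleOrder x a ≠ 0}.Finite := by
  have h := a.val.2.and a⁻¹.val.2
  refine (Filter.eventually_cofinite.1 h).subset fun x hx => ?_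
  rintro ⟨h1, h2⟩
  apply hx
  have e1 : Valued.v (a.val x) ≤ 1 := h1
  have e2 : Valued.v (a⁻¹.val x) ≤ 1 := h2
  rw [valued_idele, ← WithZero.exp_zero, WithZero.exp_le_exp] at e1 e2
  rw [ideleOrder_inv] at e2
  omega

/-- The degree over `F` of the divisor of an idele outside `S`. -/
noncomputable def ideleDegree (a : (AdeleOutside F I)ˣ) : ℤ :=
  ∑ᶠ x : Place F I, (x.degree : ℤ) * ideleOrder x a

theorem finite_support_ideleDegree (a : (AdeleOutside F I)ˣ) :
    (Function.support fun x : Place F I => (x.degree : ℤ) * ideleOrder x a).Finite :=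
  (finite_ideleOrder_ne_zero a).subset fun _ hx => right_ne_zero_of_mul hx

theorem ideleDegree_mul (a b : (AdeleOutside F I)ˣ) :
    ideleDegree (a * b) = ideleDegree a + ideleDegree b := by
  rw [ideleDegree, ideleDegree, ideleDegree, ← finsum_add_distrib (finite_support_ideleDegree a)
    (finite_support_ideleDegree b)]
  exact finsum_congr fun x => by rw [ideleOrder_mul, mul_add]

theorem ideleDegree_eq_zero {a : (AdeleOutside F I)ˣ} (h : ∀ x, ideleOrder x a = 0) :
    ideleDegree a = 0 :=
  finsum_eq_zero_of_forall_eq_zero fun x => by rw [h, mul_zero]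

theorem ideleDegree_one : ideleDegree (1 : (AdeleOutside F I)ˣ) = 0 :=
  ideleDegree_eq_zero fun x => ideleOrder_one x

theorem ideleDegree_prod {ι : Type*} (s : Finset ι) (a : ι → (AdeleOutside F I)ˣ) :
    ideleDegree (∏ i ∈ s, a i) = ∑ i ∈ s, ideleDegree (a i) := by
  classical
  induction s using Finset.induction_on with
  | empty => simp [ideleDegree_one]
  | insert i s hi ih => rw [Finset.prod_insert hi, Finset.sum_insert hi, ideleDegree_mul, ih]

theorem ideleDegree_nonneg {a : (AdeleOutside F I)ˣ} (ha : a.val ∈ integralAdeles F I) :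
    0 ≤ ideleDegree a :=
  finsum_nonneg fun x => mul_nonneg (Nat.cast_nonneg _) ((mem_integralAdeles_iff a).1 ha x)

theorem degree_le_ideleDegree {a : (AdeleOutside F I)ˣ} (ha : a.val ∈ integralAdeles F I)
    {x : Place F I} (hx : ideleOrder x a ≠ 0) : (x.degree : ℤ) ≤ ideleDegree a := by
  have h := (mem_integralAdeles_iff a).1 ha
  have h1 : 1 ≤ ideleOrder x a := by have := h x; omega
  refine le_trans ?_ (single_le_finsum x (finite_support_ideleDegree a)
    fun y => mul_nonneg (Nat.cast_nonneg _) (h y))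
  nlinarith [Nat.cast_nonneg (α := ℤ) x.degree]

theorem ideleOrder_localIdele_same {x : Place F I} {t : x.Completionˣ} (ht : x.IsUniformizer t) :
    ideleOrder x (localIdele x t) = 1 := by
  rw [ideleOrder_eq_iff, localIdele_apply_same]
  exact ht

theorem ideleOrder_localIdele_of_ne {x y : Place F I} (t : x.Completionˣ) (h : y ≠ x) :
    ideleOrder y (localIdele x t) = 0 := by
  rw [ideleOrder_eq_iff, localIdele_apply_of_ne t h, map_one, neg_zero, WithZero.exp_zero]

theorem ideleDegree_localIdele {x : Place F I} {t : x.Completionˣ} (ht : x.IsUniformizer t) :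
    ideleDegree (localIdele x t) = x.degree := by
  rw [ideleDegree, finsum_eq_single _ x fun y hy => by
    rw [ideleOrder_localIdele_of_ne t hy, mul_zero], ideleOrder_localIdele_same ht, mul_one]

/-- The exponent of a maximal ideal in the factorization of an ideal. -/
noncomputable def idealCount (x : HeightOneSpectrum F[X]) (J : Ideal F[X]) : ℕ :=
  (Associates.mk x.asIdeal).count (Associates.mk J).factors

theorem ideleOrder_principal (x : Place F I) {r : F[X]} (hr : r ≠ 0)
    (hr' : algebraMap F[X] (RatFunc F) r ≠ 0) :
    ideleOrder x (Units.map (principalAdele (F := F) (I := I)).toMonoidHom (Units.mk0 _ hr')) =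
      idealCount x.1 (Ideal.span {r}) := by
  rw [ideleOrder_eq_iff]
  change Valued.v ((algebraMap F[X] (RatFunc F) r : RatFunc F) : x.Completion) = _
  rw [HeightOneSpectrum.valuedAdicCompletion_eq_valuation',
    HeightOneSpectrum.valuation_of_algebraMap, HeightOneSpectrum.intValuation_if_neg _ hr]
  rfl

theorem ideleOrder_idealIdele (x : Place F I) (J : Ideal F[X]) (hJ : J ≠ ⊥) :
    ideleOrder x (idealIdele J hJ : (AdeleOutside F I)ˣ) = idealCount x.1 J := by
  rw [idealIdele, ideleOrder_principal x, Ideal.span_singleton_generator]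
  rwa [Ne, ← Submodule.IsPrincipal.eq_bot_iff_generator_eq_zero]

theorem idealCount_mul (x : HeightOneSpectrum F[X]) {J J' : Ideal F[X]} (hJ : J ≠ ⊥)
    (hJ' : J' ≠ ⊥) : idealCount x (J * J') = idealCount x J + idealCount x J' := by
  rw [idealCount, ← Associates.mk_mul_mk, Associates.count_mul (Associates.mk_ne_zero.2 hJ)
    (Associates.mk_ne_zero.2 hJ') x.associates_irreducible]
  rfl

theorem idealCount_self (x : HeightOneSpectrum F[X]) : idealCount x x.asIdeal = 1 :=
  Associates.count_self x.associates_irreducible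

theorem idealCount_of_ne {x y : HeightOneSpectrum F[X]} (h : x ≠ y) :
    idealCount x y.asIdeal = 0 :=
  Associates.count_eq_zero_of_ne x.associates_irreducible y.associates_irreducible fun h' =>
    h (HeightOneSpectrum.ext (associated_iff_eq.1 (Associates.mk_eq_mk_iff_associated.1 h')))

theorem idealCount_top (x : HeightOneSpectrum F[X]) : idealCount x ⊤ = 0 := by
  have := idealCount_mul x (J := ⊤) (J' := ⊤) top_ne_bot top_ne_bot
  rw [Ideal.top_mul] at this
  omega

theorem idealCount_pow (x : HeightOneSpectrum F[X]) {J : Ideal F[X]} (hJ : J ≠ ⊥) (m : ℕ) :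
    idealCount x (J ^ m) = m * idealCount x J := by
  induction m with
  | zero => rw [pow_zero, Ideal.one_eq_top, idealCount_top, zero_mul]
  | succ m ih => rw [pow_succ, idealCount_mul x (pow_ne_zero m hJ) hJ, ih, Nat.succ_mul]

theorem idealCount_prod (x : HeightOneSpectrum F[X]) {ι : Type*} (s : Finset ι)
    (J : ι → Ideal F[X]) (hJ : ∀ i ∈ s, J i ≠ ⊥) :
    idealCount x (∏ i ∈ s, J i) = ∑ i ∈ s, idealCount x (J i) := by
  classical
  induction s using Finset.induction_on with
  | empty => rw [Finset.prod_empty, Finset.sum_empty, Ideal.one_eq_top, idealCount_top]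
  | insert i s hi ih =>
    rw [Finset.prod_insert hi, Finset.sum_insert hi, idealCount_mul x (hJ i (by simp)),
      ih fun j hj => hJ j (by simp [hj])]
    exact Finset.prod_ne_zero_iff.2 fun j hj => hJ j (by simp [hj])

theorem ideal_eq_of_idealCount_eq {J J' : Ideal F[X]} (hJ : J ≠ ⊥) (hJ' : J' ≠ ⊥)
    (h : ∀ x, idealCount x J = idealCount x J') : J = J' := by
  rw [← Ideal.finprod_heightOneSpectrum_factorization hJ,
    ← Ideal.finprod_heightOneSpectrum_factorization hJ']
  exact finprod_congr fun x => congrArg (x.asIdeal ^ ·) (h x)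

theorem idealCount_eq_zero_of_not_le {x : HeightOneSpectrum F[X]} {J : Ideal F[X]}
    (h : ¬ J ≤ x.asIdeal) : idealCount x J = 0 := by
  by_contra h0
  apply h
  rw [← Ideal.dvd_iff_le, ← Associates.mk_le_mk_iff_dvd]
  exact Associates.le_of_count_ne_zero (Associates.mk_ne_zero.2 (by rintro rfl; simp at h))
    x.associates_irreducible h0

theorem not_le_of_isCoprime {x : HeightOneSpectrum F[X]} {J : Ideal F[X]} (h : IsCoprime J I)
    (hI : I ≤ x.asIdeal) : ¬ J ≤ x.asIdeal := fun hJ => x.isPrime.ne_top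
  (top_le_iff.1 ((Ideal.isCoprime_iff_sup_eq.1 h).ge.trans (sup_le hJ hI)))

/-- The degree of a polynomial without zeros in `S` is the degree of its divisor outside `S`. -/
theorem ideleDegree_principal (r : F[X]) (hr : r ≠ 0) (hI : IsCoprime (Ideal.span {r}) I)
    (hr' : algebraMap F[X] (RatFunc F) r ≠ 0) :
    ideleDegree (Units.map (principalAdele (F := F) (I := I)).toMonoidHom (Units.mk0 _ hr')) =
      r.natDegree := by
  induction r using UniqueFactorizationMonoid.induction_on_prime with
  | h₁ => exact absurd rfl hr
  | h₂ r hu =>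
    rw [Polynomial.natDegree_eq_zero_of_isUnit hu]
    refine ideleDegree_eq_zero fun x => ?_
    rw [ideleOrder_principal x hr, Ideal.span_singleton_eq_top.2 hu, idealCount_top, Nat.cast_zero]
  | h₃ r p hr0 hp ih =>
    have hspan : Ideal.span {p * r} = Ideal.span {p} * Ideal.span {r} :=
      (Ideal.span_singleton_mul_span_singleton p r).symm
    rw [hspan] at hI
    have hp' : algebraMap F[X] (RatFunc F) p ≠ 0 := left_ne_zero_of_mul (by rwa [← map_mul])
    have hr0' : algebraMap F[X] (RatFunc F) r ≠ 0 := right_ne_zero_of_mul (by rwa [← map_mul])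
    have e : Units.mk0 _ hr' = Units.mk0 _ hp' * Units.mk0 _ hr0' := Units.ext (map_mul _ _ _)
    rw [e, map_mul, ideleDegree_mul, ih hr0 hI.of_mul_left_right hr0',
      Polynomial.natDegree_mul hp.ne_zero hr0, Nat.cast_add]
    congr 1
    let y : HeightOneSpectrum F[X] := ⟨Ideal.span {p},
      (Ideal.span_singleton_prime hp.ne_zero).2 hp, by simpa using hp.ne_zero⟩
    let x : Place F I := ⟨y, fun h => not_le_of_isCoprime hI.of_mul_left_left h le_rfl⟩
    rw [ideleDegree, finsum_eq_single _ x]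
    · rw [ideleOrder_principal x hp.ne_zero, show Ideal.span {p} = x.1.asIdeal from rfl,
        idealCount_self, Nat.cast_one, mul_one, Place.degree]
      exact congrArg _ (finrank_quotient_span_eq_natDegree)
    · intro z hz
      rw [ideleOrder_principal z hp.ne_zero, show Ideal.span {p} = x.1.asIdeal from rfl,
        idealCount_of_ne (fun h => hz (Subtype.ext h)), Nat.cast_zero, mul_zero]

theorem ideleDegree_idealIdele {J : Ideal F[X]} (hJ : J ≠ ⊥) (hI : IsCoprime J I) :
    ideleDegree (idealIdele J hJ : (AdeleOutside F I)ˣ) = Module.finrank F (F[X] ⧸ J) := by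
  have h0 : Submodule.IsPrincipal.generator J ≠ 0 := by
    rwa [Ne, ← Submodule.IsPrincipal.eq_bot_iff_generator_eq_zero]
  rw [idealIdele, ideleDegree_principal _ h0 (by rwa [Ideal.span_singleton_generator]),
    ← finrank_quotient_span_eq_natDegree, Ideal.span_singleton_generator]

end Order

/-! ### Integral adelic matrices and chains of ideals -/

section IntegralMatrices

variable {F : Type*} [Field F] {I : Ideal F[X]} {n : ℕ}

/-- An element of `GL_n(A^S)` whose entries have no poles. Its inverse may have poles. -/
def IsIntegralGL (g : GL (Fin n) (AdeleOutside F I)) : Prop :=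
  ∃ M : Matrix (Fin n) (Fin n) (integralAdeles F I), g.val = M.map (integralAdeles F I).subtype

/-- The determinant of an invertible adelic matrix, as an idele. -/
noncomputable def ideleDet (g : GL (Fin n) (AdeleOutside F I)) : (AdeleOutside F I)ˣ :=
  Matrix.GeneralLinearGroup.det g

theorem ideleDet_mul (g h : GL (Fin n) (AdeleOutside F I)) :
    ideleDet (g * h) = ideleDet g * ideleDet h := map_mul _ _ _

theorem ideleDet_inv (g : GL (Fin n) (AdeleOutside F I)) :
    ideleDet g⁻¹ = (ideleDet g)⁻¹ := map_inv _ _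

theorem ideleDet_diagonalGL (d : Fin n → (AdeleOutside F I)ˣ) :
    ideleDet (diagonalGL d) = ∏ i, d i := by
  refine Units.ext ?_
  rw [Units.coe_prod]
  exact Matrix.det_diagonal

theorem val_diagonalGL {R : Type*} [CommRing R] (d : Fin n → Rˣ) :
    (diagonalGL d).val = Matrix.diagonal fun i => (d i).val := rfl

theorem val_ideleDet_eq {g : GL (Fin n) (AdeleOutside F I)}
    {M : Matrix (Fin n) (Fin n) (integralAdeles F I)}
    (h : g.val = M.map (integralAdeles F I).subtype) : (ideleDet g).val = M.det.1 := by
  change g.val.det = (integralAdeles F I).subtype M.det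
  rw [h, RingHom.map_det]
  rfl

theorem IsIntegralGL.det {g : GL (Fin n) (AdeleOutside F I)} (h : IsIntegralGL g) :
    (ideleDet g).val ∈ integralAdeles F I := by
  obtain ⟨M, hM⟩ := h
  rw [val_ideleDet_eq hM]
  exact M.det.2

theorem IsIntegralGL.mul {g h : GL (Fin n) (AdeleOutside F I)} (hg : IsIntegralGL g)
    (hh : IsIntegralGL h) : IsIntegralGL (g * h) := by
  obtain ⟨M, hM⟩ := hg
  obtain ⟨N, hN⟩ := hh
  exact ⟨M * N, by rw [Matrix.map_mul, ← hM, ← hN, Units.val_mul]⟩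

theorem isIntegralGL_of_mem {u : GL (Fin n) (AdeleOutside F I)} (hu : u ∈ integralGL F I n) :
    IsIntegralGL u := by
  obtain ⟨U, rfl⟩ := hu
  exact ⟨U.val, rfl⟩

theorem isIntegralGL_diagonalGL {d : Fin n → (AdeleOutside F I)ˣ}
    (hd : ∀ i, (d i).val ∈ integralAdeles F I) : IsIntegralGL (diagonalGL d) :=
  ⟨Matrix.diagonal fun i => ⟨_, hd i⟩, by
    rw [Matrix.diagonal_map (map_zero _), val_diagonalGL]
    rfl⟩

theorem ideleOrder_det_of_mem {u : GL (Fin n) (AdeleOutside F I)} (hu : u ∈ integralGL F I n)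
    (x : Place F I) : ideleOrder x (ideleDet u) = 0 := by
  have h1 := (mem_integralAdeles_iff _).1 (isIntegralGL_of_mem hu).det x
  have h2 := (mem_integralAdeles_iff _).1 (isIntegralGL_of_mem (inv_mem hu)).det x
  rw [ideleDet_inv, ideleOrder_inv] at h2
  omega

/-- An integral matrix lies in `GL_n(O^S)` as soon as its determinant is a unit everywhere. -/
theorem mem_integralGL_iff (g : GL (Fin n) (AdeleOutside F I)) :
    g ∈ integralGL F I n ↔ IsIntegralGL g ∧ ∀ x, ideleOrder x (ideleDet g) = 0 := by
  refine ⟨fun h => ⟨isIntegralGL_of_mem h, ideleOrder_det_of_mem h⟩, ?_⟩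
  rintro ⟨⟨M, hM⟩, h⟩
  have hinv : (ideleDet g)⁻¹.val ∈ integralAdeles F I := by
    rw [mem_integralAdeles_iff]
    intro x
    rw [ideleOrder_inv, h, neg_zero]
  have hdet : IsUnit M.det := by
    refine IsUnit.of_mul_eq_one ⟨_, hinv⟩ (Subtype.ext ?_)
    change M.det.1 * (ideleDet g)⁻¹.val = 1
    rw [← val_ideleDet_eq hM, Units.mul_inv]
  exact ⟨Matrix.GeneralLinearGroup.mk'' M hdet, Units.ext hM.symm⟩

theorem isIntegralGL_mul_unit_iff {g u : GL (Fin n) (AdeleOutside F I)}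
    (hu : u ∈ integralGL F I n) : IsIntegralGL (g * u) ↔ IsIntegralGL g := by
  refine ⟨fun h => ?_, fun h => h.mul (isIntegralGL_of_mem hu)⟩
  have := h.mul (isIntegralGL_of_mem (inv_mem hu))
  rwa [mul_inv_cancel_right] at this

theorem isIntegralGL_unit_mul_iff {g u : GL (Fin n) (AdeleOutside F I)}
    (hu : u ∈ integralGL F I n) : IsIntegralGL (u * g) ↔ IsIntegralGL g := by
  refine ⟨fun h => ?_, fun h => (isIntegralGL_of_mem hu).mul h⟩
  have := (isIntegralGL_of_mem (inv_mem hu)).mul h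
  rwa [inv_mul_cancel_left] at this

theorem ideleDegree_det_of_mem {u : GL (Fin n) (AdeleOutside F I)} (hu : u ∈ integralGL F I n) :
    ideleDegree (ideleDet u) = 0 :=
  ideleDegree_eq_zero (ideleOrder_det_of_mem hu)

theorem ideleDegree_det_mul (g h : GL (Fin n) (AdeleOutside F I)) :
    ideleDegree (ideleDet (g * h)) = ideleDegree (ideleDet g) + ideleDegree (ideleDet h) := by
  rw [ideleDet_mul, ideleDegree_mul]

/-- The matrix `diag(q_1, …, q_n)` of a chain of ideals `(q_i)`. -/
noncomputable def IdealChain.diagonal (J : IdealChain F I n) : GL (Fin n) (AdeleOutside F I) :=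
  diagonalGL fun i => idealIdele (J.ideal i) (J.ne_bot i)

theorem idealIdele_mem (J : Ideal F[X]) (hJ : J ≠ ⊥) :
    (idealIdele J hJ : (AdeleOutside F I)ˣ).val ∈ integralAdeles F I := by
  rw [mem_integralAdeles_iff]
  intro x
  rw [ideleOrder_idealIdele]
  exact Nat.cast_nonneg _

theorem isIntegralGL_and_degree_of_mem_doubleCoset (J : IdealChain F I n)
    {g : GL (Fin n) (AdeleOutside F I)}
    (hg : g ∈ DoubleCoset.doubleCoset J.diagonal (integralGL F I n : Set _) (integralGL F I n)) :
    IsIntegralGL g ∧ ideleDegree (ideleDet g) = J.degree := by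
  obtain ⟨u, hu, v, hv, rfl⟩ := DoubleCoset.mem_doubleCoset.1 hg
  rw [isIntegralGL_mul_unit_iff hv, isIntegralGL_unit_mul_iff hu]
  refine ⟨isIntegralGL_diagonalGL fun i => idealIdele_mem _ _, ?_⟩
  rw [ideleDegree_det_mul, ideleDegree_det_mul, ideleDegree_det_of_mem hu,
    ideleDegree_det_of_mem hv, IdealChain.diagonal, ideleDet_diagonalGL, ideleDegree_prod,
    zero_add, add_zero, IdealChain.degree, Nat.cast_sum]
  exact Finset.sum_congr rfl fun i _ => ideleDegree_idealIdele _ (J.coprime i)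

theorem idealCount_anti (x : HeightOneSpectrum F[X]) {J J' : Ideal F[X]} (hJ : J ≠ ⊥)
    (h : J ≤ J') : idealCount x J' ≤ idealCount x J := by
  obtain ⟨C, rfl⟩ := Ideal.dvd_iff_le.2 h
  rw [idealCount_mul x (left_ne_zero_of_mul hJ) (right_ne_zero_of_mul hJ)]
  omega

theorem valued_idealIdele (x : Place F I) {J : Ideal F[X]} (hJ : J ≠ ⊥) :
    Valued.v ((idealIdele J hJ : (AdeleOutside F I)ˣ).val x) =
      WithZero.exp (-(idealCount x.1 J : ℤ)) := by
  rw [valued_idele, ideleOrder_idealIdele]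

/-- The component of an adele at `x`, as a ring homomorphism. -/
noncomputable def adeleEval (x : Place F I) : AdeleOutside F I →+* x.Completion :=
  RestrictedProduct.evalRingHom (fun y : Place F I => y.Completion) x

/-- If `u D_J = D_{J'} w` with `u`, `w` in `GL_n(O^S)`, then the exponents of `J'` dominate those of
`J` at every place outside `S`. -/
theorem idealCount_le_of_mul_eq {J J' : IdealChain F I n} {u w : GL (Fin n) (AdeleOutside F I)}
    (hu : u ∈ integralGL F I n) (hw : w ∈ integralGL F I n)
    (h : u * J.diagonal = J'.diagonal * w) (x : Place F I) (i : Fin n) :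
    idealCount x.1 (J.ideal i) ≤ idealCount x.1 (J'.ideal i) := by
  have hval : ∀ (J : IdealChain F I n) (i : Fin n),
      Valued.v (adeleEval x (idealIdele (J.ideal i) (J.ne_bot i) : (AdeleOutside F I)ˣ).val) =
        WithZero.exp (-(idealCount x.1 (J.ideal i) : ℤ)) :=
    fun J i => valued_idealIdele x (J.ne_bot i)
  have hmono : ∀ J : IdealChain F I n, Monotone ((Valued.v : Valuation x.Completion _) ∘
      fun i => adeleEval x (idealIdele (J.ideal i) (J.ne_bot i) : (AdeleOutside F I)ˣ).val) := by
    intro J i i' hi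
    simp only [Function.comp, hval, WithZero.exp_le_exp]
    have := idealCount_anti x.1 (J.ne_bot i) (J.monotone hi)
    omega
  have hint : ∀ {u : GL (Fin n) (AdeleOutside F I)}, u ∈ integralGL F I n →
      ∀ i j, Valued.v ((u.val.map (adeleEval x)) i j) ≤ 1 := by
    rintro _ ⟨U, rfl⟩ i j
    exact (U.val i j).2 x
  have hdet : Valued.v (w.val.map (adeleEval x)).det = 1 := by
    have e : (w.val.map (adeleEval x)).det = (ideleDet w).val x :=
      (RingHom.map_det (adeleEval x) w.val).symm
    rw [e, valued_idele, ideleOrder_det_of_mem hw, neg_zero, WithZero.exp_zero]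
  have hmul : u.val.map (adeleEval x) * Matrix.diagonal (fun i => adeleEval x
      (idealIdele (J.ideal i) (J.ne_bot i) : (AdeleOutside F I)ˣ).val) =
      Matrix.diagonal (fun i => adeleEval x
      (idealIdele (J'.ideal i) (J'.ne_bot i) : (AdeleOutside F I)ˣ).val) *
      w.val.map (adeleEval x) := by
    have h1 := congrArg (fun g => g.val.map (adeleEval x)) h
    simp only [Units.val_mul, Matrix.map_mul, IdealChain.diagonal, val_diagonalGL] at h1
    rwa [Matrix.diagonal_map (map_zero _), Matrix.diagonal_map (map_zero _)] at h1
  have := valuation_le_of_mul_diagonal_eq Valued.v (hmono J) (hmono J') (hint hu) (hint hw) hdet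
    hmul i
  simp only [hval, WithZero.exp_le_exp] at this
  omega

/-- Different chains of ideals give different double cosets. -/
theorem idealChain_eq_of_mem_doubleCoset {J J' : IdealChain F I n}
    {g : GL (Fin n) (AdeleOutside F I)}
    (hg : g ∈ DoubleCoset.doubleCoset J.diagonal (integralGL F I n : Set _) (integralGL F I n))
    (hg' : g ∈ DoubleCoset.doubleCoset J'.diagonal (integralGL F I n : Set _)
      (integralGL F I n)) : J = J' := by
  obtain ⟨u, hu, v, hv, h⟩ := DoubleCoset.mem_doubleCoset.1 hg
  obtain ⟨u', hu', v', hv', h'⟩ := DoubleCoset.mem_doubleCoset.1 hg'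
  have e : u * J.diagonal * v = u' * J'.diagonal * v' := h.symm.trans h'
  have e1 : (u'⁻¹ * u) * J.diagonal = J'.diagonal * (v' * v⁻¹) := by
    rw [mul_assoc, inv_mul_eq_iff_eq_mul, ← mul_assoc, ← mul_assoc, eq_mul_inv_iff_mul_eq, e]
  have e2 : (u⁻¹ * u') * J'.diagonal = J.diagonal * (v * v'⁻¹) := by
    rw [mul_assoc, inv_mul_eq_iff_eq_mul, ← mul_assoc, ← mul_assoc, eq_mul_inv_iff_mul_eq, e]
  refine IdealChain.ext (funext fun i => ?_)
  refine ideal_eq_of_idealCount_eq (J.ne_bot i) (J'.ne_bot i) fun x => ?_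
  by_cases hx : I ≤ x.asIdeal
  · rw [idealCount_eq_zero_of_not_le (not_le_of_isCoprime (J.coprime i) hx),
      idealCount_eq_zero_of_not_le (not_le_of_isCoprime (J'.coprime i) hx)]
  · exact le_antisymm
      (idealCount_le_of_mul_eq (mul_mem (inv_mem hu') hu) (mul_mem hv' (inv_mem hv)) e1 ⟨x, hx⟩ i)
      (idealCount_le_of_mul_eq (mul_mem (inv_mem hu) hu') (mul_mem hv (inv_mem hv')) e2 ⟨x, hx⟩ i)

/-- Chains of ideals with prescribed exponents at the places outside `S`. -/
theorem exists_idealChain_count (a : Place F I → Fin n → ℕ) (ha : ∀ x, Antitone (a x))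
    (hfin : {x | ∃ i, a x i ≠ 0}.Finite) :
    ∃ J : IdealChain F I n, ∀ x i, idealCount x.1 (J.ideal i) = a x i := by
  classical
  refine ⟨⟨fun i => ∏ x ∈ hfin.toFinset, x.1.asIdeal ^ a x i, ?_, ?_, ?_⟩, ?_⟩
  · intro i i' hi
    exact Ideal.dvd_iff_le.1 (Finset.prod_dvd_prod_of_dvd _ _ fun x _ => pow_dvd_pow _ (ha x hi))
  · exact fun i => Finset.prod_ne_zero_iff.2 fun x _ => pow_ne_zero _ x.1.ne_bot
  · intro i
    refine IsCoprime.prod_left fun x _ => IsCoprime.pow_left ?_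
    rw [Ideal.isCoprime_iff_sup_eq]
    exact x.1.isMaximal.1.2 _ (left_lt_sup.2 x.2)
  · intro y i
    change idealCount y.1 (∏ x ∈ hfin.toFinset, x.1.asIdeal ^ a x i) = a y i
    rw [idealCount_prod _ _ _ fun x _ => pow_ne_zero _ x.1.ne_bot]
    simp only [idealCount_pow _ (HeightOneSpectrum.ne_bot _)]
    rw [Finset.sum_eq_single y, idealCount_self, mul_one]
    · intro x _ hx
      rw [idealCount_of_ne fun h => hx (Subtype.ext h.symm), mul_zero]
    · intro hy
      rw [idealCount_self, mul_one]
      by_contra h0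
      exact hy (hfin.mem_toFinset.2 ⟨i, h0⟩)

theorem valued_det_integers_unit {x : Place F I} (U : GL (Fin n) x.Integers) :
    Valued.v ((U.val.det : x.Integers) : x.Completion) = 1 :=
  HeightOneSpectrum.adicCompletionIntegers.isUnit_iff_valued_eq_one.1
    ((Matrix.isUnit_iff_isUnit_det _).1 U.isUnit)

/-- Integral elements of the same valuation are associated. -/
theorem exists_unit_mul_eq {x : Place F I} {a b : x.Integers} (hb : b ≠ 0)
    (h : Valued.v (a : x.Completion) = Valued.v (b : x.Completion)) :
    ∃ u : x.Integersˣ, a = u * b := by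
  have hb' : (b : x.Completion) ≠ 0 := by simpa using hb
  have hv : Valued.v ((a : x.Completion) / b) = 1 := by
    rw [map_div₀, h, div_self]
    exact (Valuation.ne_zero_iff _).2 hb'
  let c : x.Integers := ⟨(a : x.Completion) / b, hv.le⟩
  have hc : IsUnit c := HeightOneSpectrum.adicCompletionIntegers.isUnit_iff_valued_eq_one.2 hv
  refine ⟨hc.unit, Subtype.ext ?_⟩
  change (a : x.Completion) = (a : x.Completion) / b * b
  rw [div_mul_cancel₀ _ hb']

/-- Elementary divisors of a matrix over the completed local ring at `x`. -/
theorem exists_elementaryDivisors (x : Place F I) {M : Matrix (Fin n) (Fin n) x.Integers}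
    (hM : M.det ≠ 0) : ∃ (U V : GL (Fin n) x.Integers) (d : Fin n → x.Integers) (a : Fin n → ℕ),
      M = U.val * Matrix.diagonal d * V.val ∧ Antitone a ∧
      (∀ i, Valued.v (d i : x.Completion) = WithZero.exp (-(a i : ℤ))) ∧
      Valued.v (M.det : x.Completion) = WithZero.exp (-∑ i, (a i : ℤ)) := by
  obtain ⟨U, V, d, hmono, hd⟩ := exists_eq_unit_mul_diagonal_mul_unit_monotone
    (fun a : x.Integers => Valued.v (a : x.Completion)) hM
  have hdet : Valued.v (M.det : x.Completion) = ∏ i, Valued.v (d i : x.Completion) := by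
    rw [hd, Matrix.det_mul, Matrix.det_mul, Matrix.det_diagonal]
    push_cast
    rw [map_mul, map_mul, valued_det_integers_unit, valued_det_integers_unit, map_prod, one_mul,
      mul_one]
  have hd0 : ∀ i, Valued.v (d i : x.Completion) ≠ 0 := by
    intro i
    have h : Valued.v (M.det : x.Completion) ≠ 0 := (Valuation.ne_zero_iff _).2 (by simpa using hM)
    rw [hdet] at h
    exact Finset.prod_ne_zero_iff.1 h i (Finset.mem_univ i)
  have hexp : ∀ i, ∃ a : ℕ, Valued.v (d i : x.Completion) = WithZero.exp (-(a : ℤ)) := by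
    intro i
    have h1 : Valued.v (d i : x.Completion) ≤ 1 := (d i).2
    rw [← WithZero.exp_log (hd0 i)] at h1 ⊢
    rw [← WithZero.exp_zero, WithZero.exp_le_exp] at h1
    exact ⟨(-WithZero.log (Valued.v (d i : x.Completion))).toNat, by congr 1; omega⟩
  choose a ha using hexp
  refine ⟨U, V, d, a, hd, fun i i' hi => ?_, ha, ?_⟩
  · have := hmono hi
    simp only [Function.comp, ha, WithZero.exp_le_exp] at this
    omega
  · rw [hdet, ← Finset.sum_neg_distrib]
    simp only [ha]
    generalize (Finset.univ : Finset (Fin n)) = s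
    induction s using Finset.induction_on with
    | empty => simp
    | insert i s hi ih => rw [Finset.prod_insert hi, Finset.sum_insert hi, ih, WithZero.exp_add]

/-- Local factorizations with middle factors of the valuations prescribed by a chain of ideals
combine to a factorization over the adeles without poles. -/
theorem mem_doubleCoset_diagonal_of_local {g : GL (Fin n) (AdeleOutside F I)}
    {M : Matrix (Fin n) (Fin n) (integralAdeles F I)}
    (hM : g.val = M.map (integralAdeles F I).subtype) (J : IdealChain F I n)
    (U V : ∀ x : Place F I, GL (Fin n) x.Integers) (d : ∀ x : Place F I, Fin n → x.Integers)
    (h : ∀ x, M.map (integralEval x) = (U x).val * Matrix.diagonal (d x) * (V x).val)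
    (hd : ∀ x i, Valued.v (d x i : x.Completion) =
      WithZero.exp (-(idealCount x.1 (J.ideal i) : ℤ))) :
    g ∈ DoubleCoset.doubleCoset J.diagonal (integralGL F I n : Set _) (integralGL F I n) := by
  let q : Fin n → integralAdeles F I := fun i => ⟨_, idealIdele_mem (J.ideal i) (J.ne_bot i)⟩
  have hq : ∀ x i, Valued.v (integralEval x (q i) : x.Completion) =
      WithZero.exp (-(idealCount x.1 (J.ideal i) : ℤ)) :=
    fun x i => valued_idealIdele x (J.ne_bot i)
  have hunit : ∀ x i, ∃ u : x.Integersˣ, d x i = (u : x.Integers) * integralEval x (q i) := by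
    intro x i
    refine exists_unit_mul_eq ?_ ((hd x i).trans (hq x i).symm)
    intro h0
    have := hq x i
    rw [h0] at this
    exact WithZero.exp_ne_zero (this.symm.trans (map_zero _))
  choose e he using hunit
  have hMeq : M = (integralGLMk fun x => U x * diagonalGL (e x)).val * Matrix.diagonal q *
      (integralGLMk V).val := by
    refine integralMatrix_ext fun x => ?_
    have hdiag : Matrix.diagonal (d x) = (diagonalGL (e x)).val *
        (Matrix.diagonal q).map (integralEval x) := by
      rw [Matrix.diagonal_map (map_zero _), val_diagonalGL, Matrix.diagonal_mul_diagonal]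
      exact congrArg _ (funext (he x))
    rw [Matrix.map_mul, Matrix.map_mul, h x, hdiag, ← mul_assoc, ← Units.val_mul]
    rfl
  have hdiag : (Matrix.diagonal q).map (integralAdeles F I).subtype = J.diagonal.val := by
    rw [Matrix.diagonal_map (map_zero _)]
    rfl
  refine DoubleCoset.mem_doubleCoset.2
    ⟨integralGLHom F I n (integralGLMk fun x => U x * diagonalGL (e x)), ⟨_, rfl⟩,
      integralGLHom F I n (integralGLMk V), ⟨_, rfl⟩, Units.ext ?_⟩
  rw [hM, hMeq, Matrix.map_mul, Matrix.map_mul, hdiag, Units.val_mul, Units.val_mul]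
  rfl

/-- Every integral matrix lies in the double coset of some chain of ideals, by elementary divisors
at each place. -/
theorem exists_mem_doubleCoset_diagonal {g : GL (Fin n) (AdeleOutside F I)} (hg : IsIntegralGL g) :
    ∃ J : IdealChain F I n,
      g ∈ DoubleCoset.doubleCoset J.diagonal (integralGL F I n : Set _) (integralGL F I n) := by
  obtain ⟨M, hM⟩ := hg
  have hdetM : ∀ x, ((M.map (integralEval x)).det : x.Completion) = (ideleDet g).val x := by
    intro x
    rw [val_ideleDet_eq hM, ← coe_integralEval, RingHom.map_det]
    rfl
  have hdet0 : ∀ x, (M.map (integralEval x)).det ≠ 0 := by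
    intro x h0
    exact idele_apply_ne_zero (ideleDet g) x (by rw [← hdetM, h0]; rfl)
  choose U V d a hd hanti ha hsum using fun x => exists_elementaryDivisors x (hdet0 x)
  obtain ⟨J, hJ⟩ := exists_idealChain_count a hanti
    ((finite_ideleOrder_ne_zero (ideleDet g)).subset fun x => by
      rintro ⟨i, hi⟩ h0
      have h1 := hsum x
      rw [hdetM, valued_idele, h0, WithZero.exp_inj, neg_inj, eq_comm,
        Finset.sum_eq_zero_iff_of_nonneg fun _ _ => Nat.cast_nonneg _] at h1
      exact hi (by exact_mod_cast h1 i (Finset.mem_univ i)))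
  exact ⟨J, mem_doubleCoset_diagonal_of_local hM J U V d hd fun x i => by rw [ha, hJ]⟩

/-- An integral matrix with determinant of degree `d`, that is invertible over the local ring at
every place outside `s`. -/
def IsIntegralOn (s : Set (Place F I)) (d : ℤ) (g : GL (Fin n) (AdeleOutside F I)) : Prop :=
  IsIntegralGL g ∧ (∀ x ∉ s, ideleOrder x (ideleDet g) = 0) ∧ ideleDegree (ideleDet g) = d

theorem isIntegralOn_unit_mul_iff {s : Set (Place F I)} {d : ℤ}
    {u g : GL (Fin n) (AdeleOutside F I)} (hu : u ∈ integralGL F I n) :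
    IsIntegralOn s d (u * g) ↔ IsIntegralOn s d g := by
  simp only [IsIntegralOn, isIntegralGL_unit_mul_iff hu, ideleDet_mul, ideleOrder_mul,
    ideleOrder_det_of_mem hu, ideleDegree_mul, ideleDegree_det_of_mem hu, zero_add]

theorem isIntegralOn_mul_unit_iff {s : Set (Place F I)} {d : ℤ}
    {u g : GL (Fin n) (AdeleOutside F I)} (hu : u ∈ integralGL F I n) :
    IsIntegralOn s d (g * u) ↔ IsIntegralOn s d g := by
  simp only [IsIntegralOn, isIntegralGL_mul_unit_iff hu, ideleDet_mul, ideleOrder_mul,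
    ideleOrder_det_of_mem hu, ideleDegree_mul, ideleDegree_det_of_mem hu, add_zero]

end IntegralMatrices

/-! ### The matrices `diag(μ_x, …, μ_x, 1, …, 1)` -/

section StepMatrices

variable {F : Type*} [Field F] {I : Ideal F[X]} {n : ℕ}

/-- The matrix `diag(μ_x, …, μ_x, 1, …, 1)` with `j` entries `μ_x`. -/
noncomputable def stepGL (n : ℕ) (x : Place F I) (t : x.Completionˣ) (j : ℕ) :
    GL (Fin n) (AdeleOutside F I) :=
  diagonalGL fun i : Fin n => if (i : ℕ) < j then localIdele x t else 1

theorem val_stepGL {x : Place F I} {t : x.Completionˣ} (ht : x.IsUniformizer t) (j : ℕ) :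
    (stepGL n x t j).val =
      (stepMatrix n ⟨_, ht.localIdele_mem⟩ j).map (integralAdeles F I).subtype := by
  rw [stepMatrix_map, stepGL, val_diagonalGL, stepMatrix]
  congr 1
  ext1 i
  split_ifs <;> rfl

theorem ideleOrder_det_stepGL {x y : Place F I} (t : x.Completionˣ) (j : ℕ) (h : y ≠ x) :
    ideleOrder y (ideleDet (stepGL n x t j)) = 0 := by
  rw [stepGL, ideleDet_diagonalGL]
  generalize (Finset.univ : Finset (Fin n)) = s
  induction s using Finset.induction_on with
  | empty => rw [Finset.prod_empty, ideleOrder_one]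
  | insert i s hi ih =>
    rw [Finset.prod_insert hi, ideleOrder_mul, ih, add_zero]
    split_ifs
    · exact ideleOrder_localIdele_of_ne t h
    · exact ideleOrder_one y

theorem ideleDegree_det_stepGL {x : Place F I} {t : x.Completionˣ} (ht : x.IsUniformizer t)
    {j : ℕ} (hj : j ≤ n) : ideleDegree (ideleDet (stepGL n x t j)) = j * x.degree := by
  have h : ∀ i : Fin n, ideleDegree (if (i : ℕ) < j then localIdele x t else 1) =
      if (i : ℕ) < j then (x.degree : ℤ) else 0 := by
    intro i
    split_ifs
    · exact ideleDegree_localIdele ht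
    · exact ideleDegree_one
  rw [stepGL, ideleDet_diagonalGL, ideleDegree_prod, Finset.sum_congr rfl fun i _ => h i,
    ← Finset.sum_filter, Finset.sum_const, Fin.card_filter_val_lt, min_eq_right hj, nsmul_eq_mul]

/-- Division by an element of the double coset of `diag(μ_x, …, μ_x, 1, …, 1)` lowers the degree by
`j deg x` and changes nothing outside `x`; only the integrality of the quotient is a condition. -/
theorem isIntegralOn_inv_mul_iff {s : Set (Place F I)} {x : Place F I} (hx : x ∈ s)
    {t : x.Completionˣ} (ht : x.IsUniformizer t) {j : ℕ} (hj : j ≤ n) (d : ℤ)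
    {y : GL (Fin n) (AdeleOutside F I)}
    (hy : y ∈ DoubleCoset.doubleCoset (stepGL n x t j)
      (integralGL F I n : Set _) (integralGL F I n)) (g : GL (Fin n) (AdeleOutside F I)) :
    IsIntegralOn s d (y⁻¹ * g) ↔
      IsIntegralOn s (d + j * x.degree) g ∧ IsIntegralGL (y⁻¹ * g) := by
  obtain ⟨u, hu, v, hv, rfl⟩ := DoubleCoset.mem_doubleCoset.1 hy
  have hint : IsIntegralGL (u * stepGL n x t j * v) := by
    rw [isIntegralGL_mul_unit_iff hv, isIntegralGL_unit_mul_iff hu]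
    exact ⟨_, val_stepGL ht j⟩
  have hord : ∀ z ∉ s, ideleOrder z (ideleDet (u * stepGL n x t j * v)) = 0 := by
    intro z hz
    rw [ideleDet_mul, ideleDet_mul, ideleOrder_mul, ideleOrder_mul, ideleOrder_det_of_mem hu,
      ideleOrder_det_of_mem hv, ideleOrder_det_stepGL t j (by rintro rfl; exact hz hx)]
    rfl
  have hdeg : ideleDegree (ideleDet (u * stepGL n x t j * v)) = j * x.degree := by
    rw [ideleDegree_det_mul, ideleDegree_det_mul, ideleDegree_det_of_mem hu,
      ideleDegree_det_of_mem hv, ideleDegree_det_stepGL ht hj, zero_add, add_zero]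
  set y := u * stepGL n x t j * v
  have hg : g = y * (y⁻¹ * g) := (mul_inv_cancel_left y g).symm
  have hord' : ∀ z ∉ s, ideleOrder z (ideleDet g) = ideleOrder z (ideleDet (y⁻¹ * g)) := by
    intro z hz
    conv_lhs => rw [hg, ideleDet_mul, ideleOrder_mul, hord z hz, zero_add]
  have hdeg' : ideleDegree (ideleDet g) = j * x.degree + ideleDegree (ideleDet (y⁻¹ * g)) := by
    conv_lhs => rw [hg, ideleDegree_det_mul, hdeg]
  constructor
  · rintro ⟨h1, h2, h3⟩
    refine ⟨⟨?_, fun z hz => (hord' z hz).trans (h2 z hz), by rw [hdeg', h3, add_comm]⟩, h1⟩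
    rw [hg]
    exact hint.mul h1
  · rintro ⟨⟨_, h2, h3⟩, h1⟩
    exact ⟨h1, fun z hz => (hord' z hz).symm.trans (h2 z hz), by omega⟩

/-- An integral matrix is invertible over the local ring at `x` if and only if its reduction is
surjective. -/
theorem columnSpace_residueAt_eq_top_iff (x : Place F I) {g : GL (Fin n) (AdeleOutside F I)}
    {M : Matrix (Fin n) (Fin n) (integralAdeles F I)}
    (hM : g.val = M.map (integralAdeles F I).subtype) :
    columnSpace (residueAt x) M = ⊤ ↔ ideleOrder x (ideleDet g) = 0 := by
  have h1 : columnSpace (residueAt x) M = ⊤ ↔ residueAt x M.det ≠ 0 := by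
    rw [columnSpace, LinearMap.range_eq_top, RingHom.map_det, ← isUnit_iff_ne_zero,
      ← Matrix.isUnit_iff_isUnit_det]
    exact Matrix.mulVec_surjective_iff_isUnit
  have h2 := (mem_integralAdeles_iff _).1 (IsIntegralGL.det ⟨M, hM⟩) x
  rw [h1, Ne, residueAt_eq_zero_iff, ← val_ideleDet_eq hM, valued_idele, ← WithZero.exp_zero,
    WithZero.exp_lt_exp]
  omega

end StepMatrices

/-! ### Values of the Hecke correspondences -/

section HeckeValues

variable {F : Type*} [Field F] [Finite F] {I : Ideal F[X]} {n : ℕ}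

/-- The value at `g`, as an additive homomorphism on the Hecke ring. -/
noncomputable def heckeEval (g : GL (Fin n) (AdeleOutside F I)) :
    HeckeCorrespondences F I n →+ ℤ where
  toFun f := HeckeAlgebra.toFun (U := integralGL F I n) f g
  map_zero' := rfl
  map_add' _ _ := rfl

theorem hecke_ext {f f' : HeckeCorrespondences F I n} (h : ∀ g, heckeEval g f = heckeEval g f') :
    f = f' :=
  HeckeAlgebra.ext (funext h)

theorem heckeEval_mul (g : GL (Fin n) (AdeleOutside F I)) (f f' : HeckeCorrespondences F I n) :
    heckeEval g (f * f') = ∑ᶠ y : GL (Fin n) (AdeleOutside F I) ⧸ (integralGL F I n).toSubgroup,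
      heckeEval y.out f * heckeEval (y.out⁻¹ * g) f' := rfl

open Classical in
theorem heckeEval_one (g : GL (Fin n) (AdeleOutside F I)) :
    heckeEval g (1 : HeckeCorrespondences F I n) = if g ∈ integralGL F I n then 1 else 0 :=
  (HeckeAlgebra.one_apply g).trans (Set.indicator_apply _ _ _)

open Classical in
theorem heckeEval_heckeChain (J : IdealChain F I n) (g : GL (Fin n) (AdeleOutside F I)) :
    heckeEval g (heckeChain J) = if g ∈ DoubleCoset.doubleCoset J.diagonal
      (integralGL F I n : Set _) (integralGL F I n) then 1 else 0 :=
  Set.indicator_apply _ _ _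

open Classical in
theorem heckeEval_heckeSigma (x : Place F I) (t : x.Completionˣ) (j : ℕ)
    (g : GL (Fin n) (AdeleOutside F I)) :
    heckeEval g (heckeSigma n x t j) = if g ∈ DoubleCoset.doubleCoset (stepGL n x t j)
      (integralGL F I n : Set _) (integralGL F I n) then 1 else 0 :=
  Set.indicator_apply _ _ _

theorem heckeSigma_zero (x : Place F I) (t : x.Completionˣ) :
    (heckeSigma n x t 0 : HeckeCorrespondences F I n) = 1 := by
  have h : (diagonalGL fun i : Fin n => if (i : ℕ) < 0 then localIdele x t else 1) = 1 := by
    refine Units.ext ?_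
    rw [val_diagonalGL]
    simp
  rw [heckeSigma, h]
  rfl

open Classical in
/-- `T(m)` is the characteristic function of the integral matrices with determinant of degree
`m`. -/
theorem heckeEval_heckeT (m : ℕ) (g : GL (Fin n) (AdeleOutside F I)) :
    heckeEval g (heckeT F I n m) =
      if IsIntegralGL g ∧ ideleDegree (ideleDet g) = m then 1 else 0 := by
  rw [heckeT, map_sum]
  simp only [heckeEval_heckeChain]
  split_ifs with h
  · obtain ⟨J, hJ⟩ := exists_mem_doubleCoset_diagonal h.1
    rw [Finset.sum_eq_single J, if_pos hJ]
    · intro J' _ hne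
      rw [if_neg fun hJ' => hne (idealChain_eq_of_mem_doubleCoset hJ' hJ)]
    · intro hJ'
      refine absurd ((IdealChain.finite_degree_eq m).mem_toFinset.2 ?_) hJ'
      have := (isIntegralGL_and_degree_of_mem_doubleCoset J hJ).2
      rw [h.2] at this
      exact_mod_cast this.symm
  · refine Finset.sum_eq_zero fun J hJ => if_neg fun hg => h ?_
    have h1 := isIntegralGL_and_degree_of_mem_doubleCoset J hg
    have h2 : J.degree = m := (IdealChain.finite_degree_eq m).mem_toFinset.1 hJ
    rwa [h2] at h1

open Classical in
/-- The part of `T(m)` supported at the places of `s`: the characteristic function of the integral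
matrices with determinant of degree `m` that are invertible outside `s`. -/
noncomputable def heckeTOn (s : Set (Place F I)) (n m : ℕ) : HeckeCorrespondences F I n where
  toFun g := if IsIntegralOn s m g then 1 else 0
  continuous_toFun := HeckeAlgebra.continuous_of_right_invariant (U := integralGL F I n) _
    fun u hu g => by simp only [isIntegralOn_mul_unit_iff hu]
  hasCompactSupport := by
    refine HasCompactSupport.mono
      (HeckeAlgebra.hasCompactSupport (U := integralGL F I n) (heckeT F I n m)) fun g hg => ?_
    have hg' : IsIntegralOn s m g := by
      by_contra h
      exact hg (if_neg h)
    change heckeEval g (heckeT F I n m) ≠ 0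
    rw [heckeEval_heckeT, if_pos ⟨hg'.1, hg'.2.2⟩]
    exact one_ne_zero
  left_invariant u hu g := by simp only [isIntegralOn_unit_mul_iff hu]
  right_invariant u hu g := by simp only [isIntegralOn_mul_unit_iff hu]

open Classical in
theorem heckeEval_heckeTOn (s : Set (Place F I)) (m : ℕ) (g : GL (Fin n) (AdeleOutside F I)) :
    heckeEval g (heckeTOn s n m) = if IsIntegralOn s m g then 1 else 0 := rfl

theorem heckeTOn_empty (m : ℕ) :
    heckeTOn (∅ : Set (Place F I)) n m = if m = 0 then 1 else 0 := by
  classical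
  refine hecke_ext fun g => ?_
  have key : IsIntegralOn ∅ m g ↔ g ∈ integralGL F I n ∧ m = 0 := by
    rw [mem_integralGL_iff, IsIntegralOn]
    constructor
    · rintro ⟨h1, h2, h3⟩
      have h2' : ∀ x, ideleOrder x (ideleDet g) = 0 := fun x => h2 x (Set.notMem_empty x)
      refine ⟨⟨h1, h2'⟩, ?_⟩
      rw [ideleDegree_eq_zero h2'] at h3
      exact_mod_cast h3.symm
    · rintro ⟨⟨h1, h2⟩, rfl⟩
      exact ⟨h1, fun x _ => h2 x, ideleDegree_eq_zero h2⟩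
  rw [heckeEval_heckeTOn]
  simp only [key]
  by_cases hm : m = 0
  · simp only [hm, and_true, if_true, heckeEval_one]
  · simp [hm]

/-- `T(m)` only involves the places of degree at most `m`. -/
theorem heckeTOn_eq_heckeT {s : Set (Place F I)} {m : ℕ}
    (hs : ∀ x : Place F I, x.degree ≤ m → x ∈ s) : heckeTOn s n m = heckeT F I n m := by
  classical
  refine hecke_ext fun g => ?_
  rw [heckeEval_heckeTOn, heckeEval_heckeT]
  refine if_congr ⟨fun h => ⟨h.1, h.2.2⟩, fun h => ⟨h.1, fun x hx => ?_, h.2⟩⟩ rfl rfl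
  by_contra h0
  have := degree_le_ideleDegree h.1.det h0
  rw [h.2] at this
  exact hx (hs x (by exact_mod_cast this))

theorem finite_degree_le (m : ℕ) : {x : Place F I | x.degree ≤ m}.Finite := by
  refine ((finite_ideal_finrank_le (F := F) m).preimage
    (f := fun x : Place F I => x.1.asIdeal) ?_).subset fun x hx => ⟨x.1.ne_bot, hx⟩
  exact Function.Injective.injOn fun x y h => Subtype.ext (HeightOneSpectrum.ext h)

end HeckeValues

/-! ### Removing one place -/

section Recursion

variable {F : Type*} [Field F] [Finite F] {I : Ideal F[X]} {n : ℕ}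

/-- Also for infinitely many `a`, where both sides are `0` by convention. -/
theorem finsum_ite_one {α : Type*} (p : α → Prop) [DecidablePred p] :
    ∑ᶠ a, (if p a then (1 : ℤ) else 0) = (Nat.card {a // p a} : ℤ) := by
  have h := (Nat.castAddMonoidHom ℤ).map_finsum_of_injective Nat.cast_injective
    (fun a => if p a then 1 else 0)
  rw [← Set.coe_ofPred, Nat.card_coe_set_eq, ← finsum_one,
    finsum_congr fun a => finsum_eq_if (M := ℕ) (p := a ∈ {a | p a})]
  refine Eq.trans (finsum_congr fun a => ?_) h.symm
  simp

open Classical in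
/-- Convolution of `σ^x_j` with the characteristic function of a set of integral matrices counts
subspaces of codimension `j` that contain a column space modulo `x`. -/
theorem heckeEval_heckeSigma_mul {s : Set (Place F I)} {x : Place F I} (hx : x ∈ s)
    {t : x.Completionˣ} (ht : x.IsUniformizer t) {j : ℕ} (hj : j ≤ n) (d : ℤ)
    {f : HeckeCorrespondences F I n}
    (hf : ∀ h, heckeEval h f = if IsIntegralOn s d h then 1 else 0)
    {g : GL (Fin n) (AdeleOutside F I)} (hg : IsIntegralOn s (d + j * x.degree) g)
    {M : Matrix (Fin n) (Fin n) (integralAdeles F I)}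
    (hM : g.val = M.map (integralAdeles F I).subtype) :
    heckeEval g (heckeSigma n x t j * f) =
      Nat.card {W : Submodule (IsLocalRing.ResidueField x.Integers)
        (Fin n → IsLocalRing.ResidueField x.Integers) // columnSpace (residueAt x) M ≤ W ∧
        Module.finrank (IsLocalRing.ResidueField x.Integers)
          ((Fin n → IsLocalRing.ResidueField x.Integers) ⧸ W) = j} := by
  rw [← natCard_cosets_eq_natCard_subspaces (ι := (integralAdeles F I).subtype)
    Subtype.val_injective (residueAt_eq_zero_iff_dvd ht)
    (surjective_generalLinearGroup_map_residueAt x) hj (val_stepGL ht j) hM, heckeEval_mul]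
  refine Eq.trans (finsum_congr fun y => ?_) (finsum_ite_one _)
  rw [heckeEval_heckeSigma, hf]
  by_cases hy : y.out ∈ DoubleCoset.doubleCoset (stepGL n x t j)
      (integralGL F I n : Set _) (integralGL F I n)
  · rw [if_pos hy, one_mul]
    exact if_congr ((isIntegralOn_inv_mul_iff hx ht hj d hy g).trans
      ⟨fun h => ⟨hy, h.2⟩, fun h => ⟨hg, h.2⟩⟩) rfl rfl
  · rw [if_neg hy, zero_mul, if_neg fun h => hy h.1]

open Classical in
theorem heckeEval_heckeSigma_mul_of_not {s : Set (Place F I)} {x : Place F I} (hx : x ∈ s)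
    {t : x.Completionˣ} (ht : x.IsUniformizer t) {j : ℕ} (hj : j ≤ n) (d : ℤ)
    {f : HeckeCorrespondences F I n}
    (hf : ∀ h, heckeEval h f = if IsIntegralOn s d h then 1 else 0)
    {g : GL (Fin n) (AdeleOutside F I)} (hg : ¬ IsIntegralOn s (d + j * x.degree) g) :
    heckeEval g (heckeSigma n x t j * f) = 0 := by
  rw [heckeEval_mul]
  refine finsum_eq_zero_of_forall_eq_zero fun y => ?_
  rw [heckeEval_heckeSigma, hf]
  by_cases hy : y.out ∈ DoubleCoset.doubleCoset (stepGL n x t j)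
      (integralGL F I n : Set _) (integralGL F I n)
  · rw [if_neg fun h => hg ((isIntegralOn_inv_mul_iff hx ht hj d hy g).1 h).1, mul_zero]
  · rw [if_neg hy, zero_mul]

theorem PowerSeries.coeff_monomial_mul {R : Type*} [Semiring R] (m k : ℕ) (a : R)
    (φ : PowerSeries R) : PowerSeries.coeff m (PowerSeries.monomial k a * φ) =
      if k ≤ m then a * PowerSeries.coeff (m - k) φ else 0 := by
  have h : PowerSeries.monomial k a = PowerSeries.C a * PowerSeries.X ^ k := by
    rw [← PowerSeries.monomial_zero_eq_C_apply, PowerSeries.X_pow_eq,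
      PowerSeries.monomial_mul_monomial, zero_add, mul_one]
  rw [h, mul_assoc, PowerSeries.coeff_C_mul, PowerSeries.coeff_X_pow_mul']
  split_ifs <;> simp

theorem eulerPolynomial_eq_sum (x : Place F I) (t : x.Completionˣ) :
    eulerPolynomial n x t = ∑ j ∈ Finset.range (n + 1), PowerSeries.monomial (j * x.degree)
      (subspaceMoebius x.residueCard j • heckeSigma n x t j) := by
  rw [Finset.sum_range_succ', eulerPolynomial, add_comm]
  congr 1
  · rw [Finset.range_eq_Ico, Finset.sum_Ico_add' (fun j => PowerSeries.monomial (j * x.degree)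
      (subspaceMoebius x.residueCard j • heckeSigma n x t j)), zero_add, Finset.Ico_add_one_right_eq_Icc]
    rfl
  · rw [heckeSigma_zero, zero_mul]
    simp [subspaceMoebius]

/-- The generating series of the parts of `T(m)` supported at the places of `s`. -/
noncomputable def heckeSeries (s : Set (Place F I)) (n : ℕ) :
    PowerSeries (HeckeCorrespondences F I n) :=
  PowerSeries.mk (heckeTOn s n)

/-- Multiplication by the Euler polynomial at `x` removes the place `x`. At an integral matrix `g`
the values of the products with the `σ^x_j` are numbers of subspaces that contain the column space
of `g` modulo `x`, and the alternating sum of these numbers is `0` unless the column space is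
everything, that is, unless `g` is invertible at `x`. -/
theorem eulerPolynomial_mul_heckeSeries {s : Set (Place F I)} {x : Place F I} (hx : x ∈ s)
    {t : x.Completionˣ} (ht : x.IsUniformizer t) :
    eulerPolynomial n x t * heckeSeries s n = heckeSeries (s \ {x}) n := by
  classical
  ext m
  refine hecke_ext fun g => ?_
  rw [heckeSeries, heckeSeries, PowerSeries.coeff_mk, eulerPolynomial_eq_sum, Finset.sum_mul,
    map_sum, map_sum, heckeEval_heckeTOn]
  simp only [PowerSeries.coeff_monomial_mul, PowerSeries.coeff_mk, smul_mul_assoc]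
  have hdiff : IsIntegralOn (s \ {x}) m g ↔
      IsIntegralOn s m g ∧ ideleOrder x (ideleDet g) = 0 := by
    constructor
    · rintro ⟨h1, h2, h3⟩
      exact ⟨⟨h1, fun y hy => h2 y fun h => hy h.1, h3⟩, h2 x (by simp)⟩
    · rintro ⟨⟨h1, h2, h3⟩, h4⟩
      refine ⟨h1, fun y hy => ?_, h3⟩
      by_cases hyx : y = x
      · rw [hyx, h4]
      · exact h2 y fun h => hy ⟨h, hyx⟩
  have hcast : ∀ j : ℕ, j * x.degree ≤ m →
      ((m - j * x.degree : ℕ) : ℤ) + j * x.degree = m := by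
    intro j hj
    push_cast [Nat.cast_sub hj]
    ring
  by_cases hg : IsIntegralOn s m g
  · obtain ⟨M, hM⟩ := hg.1
    have hterm : ∀ j ∈ Finset.range (n + 1),
        heckeEval g (if j * x.degree ≤ m then subspaceMoebius x.residueCard j •
          (heckeSigma n x t j * heckeTOn s n (m - j * x.degree)) else 0) =
        subspaceMoebius x.residueCard j *
          Nat.card {W : Submodule (IsLocalRing.ResidueField x.Integers)
            (Fin n → IsLocalRing.ResidueField x.Integers) // columnSpace (residueAt x) M ≤ W ∧
            Module.finrank (IsLocalRing.ResidueField x.Integers)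
              ((Fin n → IsLocalRing.ResidueField x.Integers) ⧸ W) = j} := by
      intro j hj
      have hjn : j ≤ n := Nat.lt_succ_iff.1 (Finset.mem_range.1 hj)
      split_ifs with h
      · rw [map_zsmul, smul_eq_mul, heckeEval_heckeSigma_mul hx ht hjn _
          (heckeEval_heckeTOn s _) (by rwa [hcast j h]) hM]
      · -- No integral matrix has a determinant of negative degree, so there are no subspaces here.
        have hf : ∀ h, heckeEval h (0 : HeckeCorrespondences F I n) =
            if IsIntegralOn s ((m : ℤ) - j * x.degree) h then 1 else 0 := by
          intro h'
          rw [if_neg, map_zero]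
          rintro ⟨h1, -, h3⟩
          have := ideleDegree_nonneg h1.det
          push Not at h
          zify at h
          omega
        rw [← heckeEval_heckeSigma_mul hx ht hjn _ hf (by rwa [sub_add_cancel]) hM, mul_zero,
          map_zero, mul_zero]
    have := finite_quotient F x.1
    have := finite_residueField (RatFunc F) x.1
    rw [Finset.sum_congr rfl hterm]
    have hsum := sum_subspaceMoebius_mul_natCard (columnSpace (residueAt x) M)
    rw [Module.finrank_fin_fun, natCard_residueField] at hsum
    rw [hsum]
    exact if_congr ((columnSpace_residueAt_eq_top_iff x hM).trans (by simp [hdiff, hg])) rfl rfl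
  · rw [if_neg fun h => hg (hdiff.1 h).1]
    refine Finset.sum_eq_zero fun j hj => ?_
    split_ifs with h
    · rw [map_zsmul, heckeEval_heckeSigma_mul_of_not hx ht
        (Nat.lt_succ_iff.1 (Finset.mem_range.1 hj)) _ (heckeEval_heckeTOn s _)
        (by rwa [hcast j h]), smul_zero]
    · exact map_zero _

/-- Places are removed one by one, from the head of the list, until the series `1` of the empty set
of places is left. No commutativity of the Hecke ring is needed. -/
theorem prod_eulerFactor_eq_heckeSeries {t : ∀ x : Place F I, x.Completionˣ}
    (ht : ∀ x : Place F I, x.IsUniformizer (t x)) {l : List (Place F I)} (hl : l.Nodup) :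
    (l.map fun x => eulerFactor n x (t x)).prod = heckeSeries {x | x ∈ l} n := by
  induction l with
  | nil =>
    ext m
    rw [heckeSeries, PowerSeries.coeff_mk]
    have : {x : Place F I | x ∈ []} = ∅ := by ext; simp
    rw [this, heckeTOn_empty, List.map_nil, List.prod_nil, PowerSeries.coeff_one]
  | cons x l ih =>
    rw [List.nodup_cons] at hl
    have hset : {y : Place F I | y ∈ x :: l} \ {x} = {y | y ∈ l} := by
      ext y
      simp only [List.mem_cons, Set.mem_sdiff, Set.mem_ofPred_eq, Set.mem_singleton_iff]
      constructor
      · rintro ⟨h | h, h'⟩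
        · exact absurd h h'
        · exact h
      · exact fun h => ⟨Or.inr h, by rintro rfl; exact hl.1 h⟩
    have h1 := eulerPolynomial_mul_heckeSeries (n := n) (s := {y | y ∈ x :: l}) (x := x)
      (by simp) (ht x)
    rw [List.map_cons, List.prod_cons, ih hl.2, ← hset, ← h1, ← mul_assoc]
    have h2 : eulerFactor n x (t x) * eulerPolynomial n x (t x) = 1 :=
      PowerSeries.invOfUnit_mul _ _ (constantCoeff_eulerPolynomial n x (t x))
    rw [h2, one_mul]

end Recursion

theorem theorem2p7 {F : Type*} [Field F] [Finite F] (n : ℕ) (I : Ideal F[X])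
    (t : ∀ x : Place F I, x.Completionˣ) (ht : ∀ x : Place F I, x.IsUniformizer (t x)) :
    ∀ m : ℕ, ∃ s : Finset (Place F I), ∀ l : List (Place F I), l.Nodup → (∀ x ∈ s, x ∈ l) →
      PowerSeries.coeff m (l.map fun x => eulerFactor n x (t x)).prod = heckeT F I n m := by
  intro m
  -- A place of degree more than `m` cannot divide a determinant of degree `m`.
  refine ⟨(finite_degree_le m).toFinset, fun l hl hs => ?_⟩
  rw [prod_eulerFactor_eq_heckeSeries ht hl, heckeSeries, PowerSeries.coeff_mk]
  exact heckeTOn_eq_heckeT fun x hx => hs x ((finite_degree_le m).mem_toFinset.2 hx)
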